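/- Let $G$ be a finite simple planar graph, let $I_s, I_t$ be independent sets of $G$, each of size $k$, and put $X := I_s\cup I_t$. For $Y\subseteq X$ let $\mathcal C_Y:=\{v\in V(G)\setminus X : N(v)\cap X=Y\}$; if $|Y|=2$, then $\mathcal C_Y$ is called a *2-class* and the two elements of $Y$ are its *key vertices*. Let $\mathcal C_2$ denote the union of all 2-classes. Let $J\in\{I_s,I_t\}$ and let $I\subseteq \mathcal C_2$ be an independent set. - $I$ is *$J$-greedy* if there are an ordering $i_1,\dots,i_k$ of $J$ and distinct vertices $j_1,\dots,j_k\in I$ such that $\{j_1,\dots,j_t,i_{t+1},\dots,i_k\}$ is independent for every $0\le t\le k$. - $I$ is *weakly $J$-greedy* with $I$-activation pair $\{j_1,j_2\}$ if $k\ge 2$ and there are an ordering $i_1,\dots,i_k$ of $J$ and distinct vertices $j_1,\dots,j_k\in I$ such that $\{j_1,\dots,j_t,i_{t+1},\dots,i_k\}$ is independent for every $2\le t\le k$. - $I$ is *3-clean for $J$* if, for some 2-class $C$, we have $|C\cap I|\ge 3$ and $I$ is weakly $J$-greedy with an $I$-activation pair contained in $C$. - $I$ is *$(2,2)$-clean for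 $J$* if there are two distinct 2-classes $C,C'$ with a common key vertex such that $|C\cap I|=2$, $|C'\cap I|\ge 2$, and $I$ is weakly $J$-greedy with $I$-activation pair $C\cap I$. - $I$ is *clean for $J$* if it is $J$-greedy, 3-clean for $J$, or $(2,2)$-clean for $J$. If $|\mathcal C_2|\ge 21k$, then there exists an independent set $I\subseteq\mathcal C_2$ with $|I|\le 2k$ that is clean for $I_s$ and clean for $I_t$. -/

import Mathlib

open scoped Finset

namespace TokenJumping

/-- A graph is planar if it can be drawn in the Euclidean plane: vertices are distinct points, each
edge is a simple arc joining its two ends (the two orientations `d`, `d.symm` of an edge trace the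
same arc), an arc passes through no vertex other than its ends, and the arcs of two distinct edges
meet only at vertices. -/
def IsPlanar {V : Type*} (G : SimpleGraph V) : Prop :=
  ∃ (p : V → EuclideanSpace ℝ (Fin 2)) (γ : ∀ d : G.Dart, Path (p d.fst) (p d.snd)),
    Function.Injective p ∧
    (∀ d, Function.Injective (γ d)) ∧
    (∀ d, Set.range (γ d.symm) = Set.range (γ d)) ∧
    (∀ d v, p v ∈ Set.range (γ d) → v = d.fst ∨ v = d.snd) ∧
    (∀ d d' : G.Dart, d.edge ≠ d'.edge →
      Set.range (γ d) ∩ Set.range (γ d') ⊆ Set.range p)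

section Classes

variable {V : Type*} [Fintype V] [DecidableEq V] (G : SimpleGraph V) [DecidableRel G.Adj]

/-- The `X`-projection class of `Y`: the vertices outside `X` whose neighbours in `X` are exactly
the vertices of `Y`. -/
def projClass (X Y : Finset V) : Finset V :=
  {v | v ∉ X ∧ {x ∈ X | G.Adj v x} = Y}

/-- The union of all 2-classes, that is, of the classes of the 2-element subsets of `X`. -/
def twoClassVertices (X : Finset V) : Finset V :=
  (X.powersetCard 2).biUnion (projClass G X)

end Classes

section Greedy

variable {V : Type*} [DecidableEq V] (G : SimpleGraph V)

/-- `{j₁, …, jₜ, iₜ₊₁, …, iₖ}` (the entries are indexed from `0` in the code). -/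
def hybrid {k : ℕ} (i j : Fin k → V) (t : ℕ) : Set V :=
  {v | (∃ a : Fin k, (a : ℕ) < t ∧ v = j a) ∨ (∃ a : Fin k, t ≤ (a : ℕ) ∧ v = i a)}

/-- `i` is an ordering `i₁, …, iₖ` of all of `J` (where `k = |J|`), `j` is a sequence `j₁, …, jₖ` of
distinct vertices of `I`, and `{j₁, …, jₜ, iₜ₊₁, …, iₖ}` is independent for all `r ≤ t ≤ k`. -/
def IsGreedyOrder (r : ℕ) (J I : Finset V) (i j : Fin #J → V) : Prop :=
  Function.Injective i ∧ (∀ a, i a ∈ J) ∧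
  Function.Injective j ∧ (∀ a, j a ∈ I) ∧
  ∀ t : ℕ, r ≤ t → t ≤ #J → G.IsIndepSet (hybrid i j t)

/-- `I` is `J`-greedy: the tokens on `J` can be moved one by one onto vertices of `I`. -/
def IsGreedy (J I : Finset V) : Prop :=
  ∃ i j : Fin #J → V, IsGreedyOrder G 0 J I i j

/-- `I` is weakly `J`-greedy with `I`-activation pair `{a, b}`: the first two moves, from the
`J`-activation pair `{i₁, i₂}` to `{j₁, j₂} = {a, b}`, are made together. -/
def IsWeaklyGreedyWith (J I : Finset V) (a b : V) : Prop :=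
  ∃ h : 2 ≤ #J, ∃ i j : Fin #J → V, IsGreedyOrder G 2 J I i j ∧
    j ⟨0, by omega⟩ = a ∧ j ⟨1, by omega⟩ = b

end Greedy

section Clean

variable {V : Type*} [Fintype V] [DecidableEq V] (G : SimpleGraph V) [DecidableRel G.Adj]

/-- `I` is 3-clean for `J`, with set of key vertices `X`. -/
def IsThreeClean (X J I : Finset V) : Prop :=
  ∃ Y ⊆ X, #Y = 2 ∧ 3 ≤ #(projClass G X Y ∩ I) ∧
    ∃ a ∈ projClass G X Y, ∃ b ∈ projClass G X Y, IsWeaklyGreedyWith G J I a b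

/-- `I` is (2,2)-clean for `J`, with set of key vertices `X`: two distinct 2-classes `C`, `C'` with a
common key vertex `x` each contain two vertices of `I`, and the `I`-activation pair is `C ∩ I`. -/
def IsTwoTwoClean (X J I : Finset V) : Prop :=
  ∃ Y ⊆ X, ∃ Y' ⊆ X, #Y = 2 ∧ #Y' = 2 ∧ Y ≠ Y' ∧ (∃ x, x ∈ Y ∧ x ∈ Y') ∧
    2 ≤ #(projClass G X Y' ∩ I) ∧
    ∃ a b, projClass G X Y ∩ I = {a, b} ∧ IsWeaklyGreedyWith G J I a b

/-- `I` is clean for `J`, with set of key vertices `X`. -/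
def IsClean (X J I : Finset V) : Prop :=
  IsGreedy G J I ∨ IsThreeClean G X J I ∨ IsTwoTwoClean G X J I

end Clean

end TokenJumping

/-!
Planarity enters only through the absence of `K₅` and `K₃₃` minors. A planar graph with such a
minor would give a drawing of `K₅` or `K₃₃` in which disjoint edges have disjoint curves. For two
disjoint curves `γ` and `δ`, following a continuous logarithm of `γ s - δ t` around the parameter
square gives a relation between integers which record how each curve winds about the ends of the
other. Summed over all pairs of disjoint edges, these relations equate an even and an odd number.

A graph on `n ≥ 2` vertices without `K₅` minor has at most `3 * n - 5` edges. Hence every such graph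
is `5`-degenerate, and contracting the vertices of 2-classes onto key vertices shows that there are
fewer than `3 * #X` nonempty 2-classes. So some 2-class has six vertices of low degree, or two
2-classes with a common key vertex have four such vertices each. The excluded minors then provide
three independent vertices in one class, or two and two in the two classes. Because these at most
four vertices have low degree, degeneracy extends them to an independent set of size at least `k`.

Finally, a vertex of `I` has at most two neighbours in `J`, and the chosen vertices make up a
surplus: some `S ⊆ J` contains all the `J`-neighbours of more than `#S` vertices of `I`. By a double
count, `J` can be reduced to this `S` one vertex at a time such that every intermediate set contains
all the `J`-neighbours of at least as many vertices of `I` as it has elements. Read backwards, this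
is the required order of `J`, and Hall's theorem selects the vertices of `I`.
-/

namespace TokenJumping

section ContinuousLog

open Complex

theorem exists_continuous_log {A : Type*} [TopologicalSpace A] [SimplyConnectedSpace A]
    [LocallyPathConnectedSpace A] {f : A → ℂ} (hf : Continuous f) (hf₀ : ∀ a, f a ≠ 0) :
    ∃ L : A → ℂ, Continuous L ∧ ∀ a, exp (L a) = f a := by
  obtain ⟨a₀⟩ : Nonempty A := inferInstance
  obtain ⟨F, ⟨-, hF⟩, -⟩ := isCoveringMapOn_exp.existsUnique_continuousMap_lifts
    (⟨f, hf⟩ : C(A, ℂ)) (exp_log (hf₀ a₀)) (fun a => hf₀ a)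
  exact ⟨F, F.continuous, fun a => congrFun hF a⟩

theorem sub_eq_sub_of_exp_eq {L L' : ℝ → ℂ} (hL : Continuous L) (hL' : Continuous L')
    (h : ∀ s, exp (L s) = exp (L' s)) (s t : ℝ) : L s - L t = L' s - L' t := by
  have lift_unique := isCoveringMapOn_exp.existsUnique_continuousMap_lifts
    (⟨fun s => exp (L s), by fun_prop⟩ : C(ℝ, ℂ)) (a₀ := t) (e₀ := L t) rfl
    (fun a => exp_ne_zero _)
  have hLL' := lift_unique.unique (y₁ := ⟨L, hL⟩)
    (y₂ := ⟨fun s => L' s + (L t - L' t), by fun_prop⟩) ⟨rfl, rfl⟩ ⟨by simp, by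
      ext s
      simp only [Function.comp_apply, ContinuousMap.coe_mk]
      rw [exp_add, exp_sub, ← h s, ← h t, div_self (exp_ne_zero _), mul_one]⟩
  have hs : L s = L' s + (L t - L' t) := DFunLike.congr_fun hLL' s
  rw [hs]
  ring

open Classical in
/-- The increment over `[0, 1]` of a continuous logarithm of `g : ℝ → ℂ`; it is `0` by convention
if `g` has no continuous logarithm. -/
noncomputable def logIncrement (g : ℝ → ℂ) : ℂ :=
  if h : ∃ L : ℝ → ℂ, Continuous L ∧ ∀ s, exp (L s) = g s then h.choose 1 - h.choose 0 else 0

theorem logIncrement_eq {g L : ℝ → ℂ} (hL : Continuous L) (h : ∀ s, exp (L s) = g s) :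
    logIncrement g = L 1 - L 0 := by
  have hex : ∃ L : ℝ → ℂ, Continuous L ∧ ∀ s, exp (L s) = g s := ⟨L, hL, h⟩
  rw [logIncrement, dif_pos hex]
  exact sub_eq_sub_of_exp_eq hex.choose_spec.1 hL
    (fun s => (hex.choose_spec.2 s).trans (h s).symm) 1 0

theorem exp_logIncrement {g : ℝ → ℂ} (hg : Continuous g) (hg₀ : ∀ s, g s ≠ 0) :
    exp (logIncrement g) = g 1 / g 0 := by
  obtain ⟨L, hL, hLg⟩ := exists_continuous_log hg hg₀
  rw [logIncrement_eq hL hLg, exp_sub, hLg, hLg]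

theorem logIncrement_sub_comm {γ δ : ℝ → ℂ} (hγ : Continuous γ) (hδ : Continuous δ)
    (hγδ : ∀ s t, γ s ≠ δ t) :
    logIncrement (fun s => γ s - δ 0) + logIncrement (fun t => δ t - γ 1) =
      logIncrement (fun s => γ s - δ 1) + logIncrement (fun t => δ t - γ 0) := by
  obtain ⟨L, hL, hexp⟩ := exists_continuous_log (A := ℝ × ℝ) (f := fun x => γ x.1 - δ x.2)
    (by fun_prop) (fun x => sub_ne_zero.2 (hγδ _ _))
  have along_γ (t : ℝ) : logIncrement (fun s => γ s - δ t) = L (1, t) - L (0, t) :=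
    logIncrement_eq (L := fun s => L (s, t)) (by fun_prop) (fun s => hexp (s, t))
  have along_δ (s : ℝ) : logIncrement (fun t => δ t - γ s) = L (s, 1) - L (s, 0) := by
    rw [logIncrement_eq (L := fun t => L (s, t) + Real.pi * I) (by fun_prop)
      (fun t => by rw [exp_add, hexp, exp_pi_mul_I]; ring)]
    ring
  rw [along_γ, along_γ, along_δ, along_δ]
  ring

end ContinuousLog

section VanKampen

open Complex

variable {ι : Type*}

/-- A logarithm of `p w - p v`, chosen so that exchanging `v` and `w` adds or subtracts `π * I`
according to the order of the ranks `f v` and `f w`. -/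
noncomputable def dirLog (f : ι → ℕ) (p : ι → ℂ) (v w : ι) : ℂ :=
  if f w < f v then log (p v - p w) + Real.pi * I else log (p w - p v)

theorem exp_dirLog (f : ι → ℕ) {p : ι → ℂ} {v w : ι} (h : p v ≠ p w) :
    exp (dirLog f p v w) = p w - p v := by
  rw [dirLog]
  split_ifs
  · rw [exp_add, exp_log (sub_ne_zero.2 h), exp_pi_mul_I]
    ring
  · exact exp_log (sub_ne_zero.2 h.symm)

theorem dirLog_sub_dirLog {f : ι → ℕ} (hf : Function.Injective f) (p : ι → ℂ) {v w : ι}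
    (hvw : v ≠ w) :
    dirLog f p v w - dirLog f p w v =
      (2 * (if f w < f v then 1 else 0 : ℤ) - 1) * (Real.pi * I) := by
  rw [dirLog, dirLog]
  rcases (hf.ne hvw).lt_or_gt with h | h
  all_goals
    rw [if_neg h.not_gt, if_pos h]
    simp only [if_neg h.not_gt, if_pos h]
    push_cast
    ring

/-- A drawing of `H` in the complex plane in which only curves of edges with disjoint ends have to
be disjoint. -/
def HasDisjointEdgeDrawing (H : SimpleGraph ι) : Prop :=
  ∃ (p : ι → ℂ) (γ : ι → ι → ℝ → ℂ),
    (∀ i j, H.Adj i j → Continuous (γ i j) ∧ γ i j 0 = p i ∧ γ i j 1 = p j) ∧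
    ∀ i j k l, H.Adj i j → H.Adj k l → i ≠ k → i ≠ l → j ≠ k → j ≠ l → ∀ s t, γ i j s ≠ γ k l t

-- The right-hand side is odd exactly if the chords `ij` and `kl` cross when the vertices are placed
-- on a circle in the order of their ranks.
theorem HasDisjointEdgeDrawing.exists_vanKampen_relation {H : SimpleGraph ι}
    (hH : HasDisjointEdgeDrawing H) {f : ι → ℕ} (hf : Function.Injective f) :
    ∃ n : ι → ι → ι → ℤ, ∀ i j k l, H.Adj i j → H.Adj k l → i ≠ k → i ≠ l → j ≠ k → j ≠ l →
      n k i j + n j k l - n l i j - n i k l =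
        (if f i < f k then 1 else 0) + (if f k < f j then 1 else 0) +
          (if f j < f l then 1 else 0) + (if f l < f i then 1 else 0) - 2 := by
  obtain ⟨p, γ, hγ, hdisj⟩ := hH
  have exists_winding (v i j : ι) (hij : H.Adj i j) (hv : ∀ s, γ i j s ≠ p v) :
      ∃ n : ℤ, logIncrement (fun s => γ i j s - p v) =
        dirLog f p v j - dirLog f p v i + n * (2 * Real.pi * I) := by
    obtain ⟨hc, h0, h1⟩ := hγ i j hij
    refine exp_eq_exp_iff_exists_int.1 ?_
    rw [exp_logIncrement (by fun_prop) (fun s => sub_ne_zero.2 (hv s)), exp_sub,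
      exp_dirLog f (h1 ▸ (hv 1).symm), exp_dirLog f (h0 ▸ (hv 0).symm), h0, h1]
  choose! n hn using exists_winding
  refine ⟨n, fun i j k l hij hkl hik hil hjk hjl => ?_⟩
  obtain ⟨hc, h0, h1⟩ := hγ i j hij
  obtain ⟨hc', h0', h1'⟩ := hγ k l hkl
  have hd := hdisj i j k l hij hkl hik hil hjk hjl
  have square := logIncrement_sub_comm hc hc' hd
  rw [h0, h1, h0', h1', hn k i j hij (h0' ▸ (hd · 0)), hn l i j hij (h1' ▸ (hd · 1)),
    hn j k l hkl (h1 ▸ fun t => (hd 1 t).symm), hn i k l hkl (h0 ▸ fun t => (hd 0 t).symm)]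
    at square
  refine Int.cast_injective (α := ℂ) (mul_right_cancel₀ two_pi_I_ne_zero ?_)
  have swap_ki := dirLog_sub_dirLog hf p hik.symm
  have swap_jk := dirLog_sub_dirLog hf p hjk
  have swap_lj := dirLog_sub_dirLog hf p hjl.symm
  have swap_il := dirLog_sub_dirLog hf p hil
  push_cast at swap_ki swap_jk swap_lj swap_il ⊢
  linear_combination square + swap_ki + swap_jk + swap_lj + swap_il

/-- The complete graph `K₅`. -/
abbrev K₅ : SimpleGraph (Fin 5) := ⊤

/-- The complete bipartite graph `K₃,₃`. -/
abbrev K₃₃ : SimpleGraph (Fin 3 ⊕ Fin 3) := completeBipartiteGraph (Fin 3) (Fin 3)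

-- Each `n v i j` occurs in exactly two of the relations, so their left-hand sides have an even sum,
-- but an odd number of the pairs of disjoint edges cross as chords.
theorem not_hasDisjointEdgeDrawing_K₅ : ¬ HasDisjointEdgeDrawing K₅ := by
  intro hK
  obtain ⟨n, hn⟩ := hK.exists_vanKampen_relation (f := Fin.val) Fin.val_injective
  have rel (i j k l : Fin 5) (h : i ≠ j ∧ k ≠ l ∧ i ≠ k ∧ i ≠ l ∧ j ≠ k ∧ j ≠ l := by decide) :=
    hn i j k l h.1 h.2.1 h.2.2.1 h.2.2.2.1 h.2.2.2.2.1 h.2.2.2.2.2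
  have h₁ := rel 0 1 2 3
  have h₂ := rel 0 1 2 4
  have h₃ := rel 0 1 3 4
  have h₄ := rel 0 2 1 3
  have h₅ := rel 0 2 1 4
  have h₆ := rel 0 2 3 4
  have h₇ := rel 0 3 1 2
  have h₈ := rel 0 3 1 4
  have h₉ := rel 0 3 2 4
  have h₁₀ := rel 0 4 1 2
  have h₁₁ := rel 0 4 1 3
  have h₁₂ := rel 0 4 2 3
  have h₁₃ := rel 1 2 3 4
  have h₁₄ := rel 1 3 2 4
  have h₁₅ := rel 1 4 2 3
  simp only [Fin.isValue, Fin.val_fin_lt, Fin.reduceLT, if_true, if_false] at *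
  omega

theorem not_hasDisjointEdgeDrawing_K₃₃ : ¬ HasDisjointEdgeDrawing K₃₃ := by
  intro hK
  have rank_injective :
      Function.Injective (Sum.elim Fin.val fun j => 3 + j.val : Fin 3 ⊕ Fin 3 → ℕ) :=
    Fin.val_injective.sumElim (fun i j h => by omega) (by omega)
  obtain ⟨n, hn⟩ := hK.exists_vanKampen_relation rank_injective
  have rel (a b c d : Fin 3) (h : a ≠ c ∧ b ≠ d := by decide) :
      n (.inl c) (.inl a) (.inr b) + n (.inr b) (.inl c) (.inr d) -
          n (.inr d) (.inl a) (.inr b) - n (.inl a) (.inl c) (.inr d) =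
        (if a < c then 1 else 0) + (if b < d then 1 else 0) - 1 := by
    have ha : ¬ 3 + d.val < a := by omega
    have hc : c.val < 3 + b := by omega
    have := hn (.inl a) (.inr b) (.inl c) (.inr d) (by simp) (by simp) (by simpa using h.1)
      (by simp) (by simp) (by simpa using h.2)
    simp only [Sum.elim_inl, Sum.elim_inr, ha, hc, add_lt_add_iff_left, Fin.val_fin_lt, if_true,
      if_false] at this
    omega
  have h₁ := rel 0 0 1 1
  have h₂ := rel 0 0 1 2
  have h₃ := rel 0 1 1 0
  have h₄ := rel 0 1 1 2
  have h₅ := rel 0 2 1 0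
  have h₆ := rel 0 2 1 1
  have h₇ := rel 0 0 2 1
  have h₈ := rel 0 0 2 2
  have h₉ := rel 0 1 2 0
  have h₁₀ := rel 0 1 2 2
  have h₁₁ := rel 0 2 2 0
  have h₁₂ := rel 0 2 2 1
  have h₁₃ := rel 1 0 2 1
  have h₁₄ := rel 1 0 2 2
  have h₁₅ := rel 1 1 2 0
  have h₁₆ := rel 1 1 2 2
  have h₁₇ := rel 1 2 2 0
  have h₁₈ := rel 1 2 2 1
  simp only [Fin.isValue, Fin.reduceLT, if_true, if_false] at *
  omega

end VanKampen

section Minors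

open SimpleGraph

variable {U V W : Type*} {F : SimpleGraph U} {G : SimpleGraph V} {H : SimpleGraph W}

/-- `H` is a minor of `G`: disjoint connected branch sets in `G` represent the vertices of `H` such
that adjacent vertices of `H` have adjacent branch sets. -/
def IsMinor (H : SimpleGraph W) (G : SimpleGraph V) : Prop :=
  ∃ B : W → Set V, (∀ a, (G.induce (B a)).Connected) ∧ Pairwise (Function.onFun Disjoint B) ∧
    ∀ a b, H.Adj a b → ∃ x ∈ B a, ∃ y ∈ B b, G.Adj x y

theorem connected_induce_singleton (x : V) : (G.induce {x}).Connected :=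
  ⟨.of_subsingleton⟩

theorem connected_induce_insert {x : V} {S : Set V} (hS : ∀ v ∈ S, G.Adj x v) :
    (G.induce (insert x S)).Connected := by
  refine induce_connected_of_patches x (Set.mem_insert x S) fun {v} hv => ?_
  obtain rfl | hv := hv
  · exact ⟨{v}, by simp, rfl, rfl, .refl _⟩
  · exact ⟨{x, v}, Set.insert_subset_insert (Set.singleton_subset_iff.2 hv), by simp, by simp,
      (induce_pair_connected_of_adj (hS v hv)).preconnected _ _⟩

theorem isMinor_of_isContained (h : H ⊑ G) : IsMinor H G := by
  obtain ⟨f⟩ := h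
  refine ⟨fun a => {f a}, fun a => connected_induce_singleton _, fun a b hab => ?_,
    fun a b hab => ?_⟩
  · exact Set.disjoint_singleton.2 (f.injective.ne hab)
  · exact ⟨_, rfl, _, rfl, f.toHom.map_adj hab⟩

theorem connected_induce_biUnion {S : Set V} (hS : (G.induce S).Connected) {C : V → Set U}
    (hC : ∀ x ∈ S, (F.induce (C x)).Connected)
    (hadj : ∀ x ∈ S, ∀ y ∈ S, G.Adj x y → ∃ u ∈ C x, ∃ v ∈ C y, F.Adj u v) :
    (F.induce (⋃ x ∈ S, C x)).Connected := by
  have exists_patch {x y : S} (w : (G.induce S).Walk x y) :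
      ∃ T ⊆ ⋃ z ∈ S, C z, C x ⊆ T ∧ C y ⊆ T ∧ (F.induce T).Connected := by
    induction w with
    | @nil x =>
      exact ⟨C x, Set.subset_biUnion_of_mem x.2, subset_rfl, subset_rfl, hC x x.2⟩
    | @cons x y z hxy _ ih =>
      obtain ⟨T, hTS, hyT, hzT, hT⟩ := ih
      obtain ⟨u, hu, v, hv, huv⟩ := hadj x x.2 y y.2 hxy
      exact ⟨C x ∪ T, Set.union_subset (Set.subset_biUnion_of_mem x.2) hTS,
        Set.subset_union_left, hzT.trans Set.subset_union_right,
        connected_induce_union (hC x x.2).preconnected hT.preconnected hu (hyT hv) huv⟩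
  obtain ⟨x₀⟩ := hS.nonempty
  obtain ⟨u₀, hu₀⟩ := (hC x₀ x₀.2).nonempty
  refine induce_connected_of_patches u₀ (Set.mem_biUnion x₀.2 hu₀) fun {v} hv => ?_
  obtain ⟨x, hx, hvx⟩ := Set.mem_iUnion₂.1 hv
  obtain ⟨w⟩ := hS.preconnected x₀ ⟨x, hx⟩
  obtain ⟨T, hTS, hx₀T, hxT, hT⟩ := exists_patch w
  exact ⟨T, hTS, hx₀T hu₀, hxT hvx, hT.preconnected _ _⟩

theorem IsMinor.trans (hHG : IsMinor H G) (hGF : IsMinor G F) : IsMinor H F := by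
  obtain ⟨B, hB, hBdisj, hBadj⟩ := hHG
  obtain ⟨C, hC, hCdisj, hCadj⟩ := hGF
  refine ⟨fun a => ⋃ x ∈ B a, C x, fun a => ?_, fun a b hab => ?_, fun a b hab => ?_⟩
  · exact connected_induce_biUnion (hB a) (fun x _ => hC x) fun x _ y _ => hCadj x y
  · simp only [Function.onFun, Set.disjoint_iUnion_left, Set.disjoint_iUnion_right]
    exact fun x hx y hy => hCdisj ((hBdisj hab).ne_of_mem hy hx)
  · obtain ⟨x, hx, y, hy, hxy⟩ := hBadj a b hab
    obtain ⟨u, hu, v, hv, huv⟩ := hCadj x y hxy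
    exact ⟨u, Set.mem_biUnion hx hu, v, Set.mem_biUnion hy hv, huv⟩

theorem isMinor_K₅_of_isNClique_four {s : Finset V} (hs : G.IsNClique 4 s) {S : Set V}
    (hS : (G.induce S).Connected) (hsS : ∀ x ∈ s, x ∉ S) (hadj : ∀ x ∈ s, ∃ y ∈ S, G.Adj x y) :
    IsMinor K₅ G := by
  have top_isMinor : IsMinor (⊤ : SimpleGraph (Option s)) G := by
    refine ⟨fun o => o.elim S fun x => {x.1}, ?_, ?_, ?_⟩
    · rintro (_ | x)
      exacts [hS, connected_induce_singleton _]
    · rintro (_ | x) (_ | y) hxy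
      · exact absurd rfl hxy
      · exact Set.disjoint_singleton_right.2 (hsS y y.2)
      · exact Set.disjoint_singleton_left.2 (hsS x x.2)
      · exact Set.disjoint_singleton.2 fun h => hxy (congrArg some (Subtype.ext h))
    · rintro (_ | x) (_ | y) hxy
      · exact absurd rfl hxy
      · obtain ⟨z, hz, hyz⟩ := hadj y y.2
        exact ⟨z, hz, y, rfl, hyz.symm⟩
      · obtain ⟨z, hz, hxz⟩ := hadj x x.2
        exact ⟨x, rfl, z, hz, hxz⟩
      · exact ⟨x, rfl, y, rfl, hs.isClique x.2 y.2 fun h => hxy (congrArg some (Subtype.ext h))⟩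
  have card_option : Fintype.card (Option s) = 5 := by simp [hs.card_eq]
  exact (isMinor_of_isContained (isContained_top_iff.2
    ⟨(Fintype.equivFinOfCardEq card_option).symm.toEmbedding⟩)).trans top_isMinor

theorem isMinor_K₃₃_of_common_neighbors {u v : V} (huv : u ≠ v) {S : Set V}
    (hS : (G.induce S).Connected) (huS : u ∉ S) (hvS : v ∉ S) {T : Finset V} (hT : 3 ≤ #T)
    (hTS : ∀ t ∈ T, t ∉ S) (hTu : ∀ t ∈ T, G.Adj u t) (hTv : ∀ t ∈ T, G.Adj v t)
    (hadj : ∀ t ∈ T, ∃ x ∈ S, G.Adj x t) : IsMinor K₃₃ G := by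
  obtain ⟨t⟩ : Nonempty (Fin 3 ↪ T) := Function.Embedding.nonempty_of_card_le (by simpa)
  have ht (i : Fin 3) : (t i : V) ∈ T := (t i).2
  have apex_adj (i j : Fin 3) :
      ∃ x ∈ (![{u}, {v}, S] : Fin 3 → Set V) i, G.Adj x (t j) := by
    fin_cases i
    exacts [⟨u, rfl, hTu _ (ht j)⟩, ⟨v, rfl, hTv _ (ht j)⟩, hadj _ (ht j)]
  have apex_disjoint (i j : Fin 3) (hij : i < j) :
      Disjoint ((![{u}, {v}, S] : Fin 3 → Set V) i) ((![{u}, {v}, S] : Fin 3 → Set V) j) := by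
    fin_cases i <;> fin_cases j <;> first | exact absurd hij (by decide) | simp [huv, huS, hvS]
  have apex_notMem (i j : Fin 3) : (t j : V) ∉ (![{u}, {v}, S] : Fin 3 → Set V) i := by
    fin_cases i
    exacts [(hTu _ (ht j)).ne', (hTv _ (ht j)).ne', hTS _ (ht j)]
  refine ⟨Sum.elim ![{u}, {v}, S] fun i => {(t i : V)}, ?_, ?_, ?_⟩
  · rintro (i | i)
    · fin_cases i
      exacts [connected_induce_singleton u, connected_induce_singleton v, hS]
    · exact connected_induce_singleton _
  · rintro (i | i) (j | j) hij
    · rcases lt_or_gt_of_ne (fun h => hij (congrArg _ h) : i ≠ j) with h | h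
      exacts [apex_disjoint i j h, (apex_disjoint j i h).symm]
    · exact Set.disjoint_singleton_right.2 (apex_notMem i j)
    · exact Set.disjoint_singleton_left.2 (apex_notMem j i)
    · exact Set.disjoint_singleton.2 fun h => hij (congrArg _ (t.injective (Subtype.ext h)))
  · rintro (i | i) (j | j) hij
    · simp at hij
    · obtain ⟨x, hx, hxt⟩ := apex_adj i j
      exact ⟨x, hx, _, rfl, hxt⟩
    · obtain ⟨x, hx, hxt⟩ := apex_adj j i
      exact ⟨_, rfl, x, hx, hxt.symm⟩
    · simp at hij

end Minors

section Planar

open SimpleGraph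

variable {V W E : Type*} [TopologicalSpace E] {G : SimpleGraph V} {H : SimpleGraph W} {p : V → E}

/-- The part of a drawing of `G` covered by the vertices in `S` and the edges inside `S`. -/
def region (γ : ∀ d : G.Dart, Path (p d.fst) (p d.snd)) (S : Set V) : Set E :=
  p '' S ∪ {x | ∃ d : G.Dart, d.fst ∈ S ∧ d.snd ∈ S ∧ x ∈ Set.range (γ d)}

theorem joinedIn_region (γ : ∀ d : G.Dart, Path (p d.fst) (p d.snd)) {S : Set V}
    (hS : (G.induce S).Connected) {x y : V} (hx : x ∈ S) (hy : y ∈ S) :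
    JoinedIn (region γ S) (p x) (p y) := by
  have joinedIn_of_walk {x y : S} (w : (G.induce S).Walk x y) :
      JoinedIn (region γ S) (p x) (p y) := by
    induction w with
    | @nil x => exact JoinedIn.refl (.inl (Set.mem_image_of_mem p x.2))
    | @cons x y z hxy _ ih =>
      let d : G.Dart := ⟨(x, y), hxy⟩
      exact JoinedIn.trans ⟨γ d, fun t => .inr ⟨d, x.2, y.2, t, rfl⟩⟩ ih
  obtain ⟨w⟩ := hS.preconnected ⟨x, hx⟩ ⟨y, hy⟩
  exact joinedIn_of_walk w

theorem disjoint_region {γ : ∀ d : G.Dart, Path (p d.fst) (p d.snd)} (hp : Function.Injective p)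
    (hv : ∀ d v, p v ∈ Set.range (γ d) → v = d.fst ∨ v = d.snd)
    (hγ : ∀ d d' : G.Dart, d.edge ≠ d'.edge →
      Set.range (γ d) ∩ Set.range (γ d') ⊆ Set.range p)
    {S T : Set V} (hST : Disjoint S T) : Disjoint (region γ S) (region γ T) := by
  have vertex_notMem {S T : Set V} (hST : Disjoint S T) {v : V} (hvS : v ∈ S) {d : G.Dart}
      (hd₁ : d.fst ∈ T) (hd₂ : d.snd ∈ T) : p v ∉ Set.range (γ d) := by
    intro hx
    rcases hv d v hx with rfl | rfl
    exacts [Set.disjoint_left.1 hST hvS hd₁, Set.disjoint_left.1 hST hvS hd₂]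
  rw [Set.disjoint_left]
  rintro z (⟨v, hvS, rfl⟩ | ⟨d, hd₁, hd₂, hz⟩) (⟨w, hwT, h⟩ | ⟨d', hd₁', hd₂', hz'⟩)
  · exact Set.disjoint_left.1 hST hvS (hp h ▸ hwT)
  · exact vertex_notMem hST hvS hd₁' hd₂' hz'
  · subst h
    exact vertex_notMem hST.symm hwT hd₁ hd₂ hz
  · have edge_ne : d.edge ≠ d'.edge := by
      intro h
      rcases (dart_edge_eq_iff d d').1 h with rfl | rfl
      exacts [Set.disjoint_left.1 hST hd₁ hd₁', Set.disjoint_left.1 hST hd₁ hd₂']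
    obtain ⟨v, rfl⟩ := hγ d d' edge_ne ⟨hz, hz'⟩
    rcases hv d v hz with rfl | rfl
    exacts [vertex_notMem hST hd₁ hd₁' hd₂' hz', vertex_notMem hST hd₂ hd₁' hd₂' hz']

theorem IsPlanar.hasDisjointEdgeDrawing (hG : IsPlanar G) (hHG : IsMinor H G) :
    HasDisjointEdgeDrawing H := by
  obtain ⟨p, γ, hp, -, -, hv, hγ⟩ := hG
  obtain ⟨B, hB, hBdisj, hBadj⟩ := hHG
  choose r hr using fun a => Set.nonempty_coe_sort.1 (hB a).nonempty
  let φ := Complex.orthonormalBasisOneI.repr.symm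
  have exists_curve (a b : W) (hab : H.Adj a b) : ∃ c : ℝ → EuclideanSpace ℝ (Fin 2),
      Continuous c ∧ c 0 = p (r a) ∧ c 1 = p (r b) ∧ ∀ s, c s ∈ region γ (B a ∪ B b) := by
    obtain ⟨x, hx, y, hy, hxy⟩ := hBadj a b hab
    have union_connected :=
      connected_induce_union (hB a).preconnected (hB b).preconnected hx hy hxy
    obtain ⟨c, hc⟩ := joinedIn_region γ union_connected (.inl (hr a)) (.inr (hr b))
    exact ⟨c.extend, c.continuous_extend, c.extend_zero, c.extend_one, fun s => hc _⟩
  choose! c hc hc₀ hc₁ hcmem using exists_curve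
  refine ⟨φ ∘ p ∘ r, fun a b s => φ (c a b s), fun a b hab => ⟨?_, ?_, ?_⟩, ?_⟩
  · exact φ.continuous.comp (hc a b hab)
  · simp [hc₀ a b hab]
  · simp [hc₁ a b hab]
  · intro i j k l hij hkl hik hil hjk hjl s t
    have hdisj : Disjoint (B i ∪ B j) (B k ∪ B l) := by
      rw [Set.disjoint_union_left, Set.disjoint_union_right, Set.disjoint_union_right]
      exact ⟨⟨hBdisj hik, hBdisj hil⟩, hBdisj hjk, hBdisj hjl⟩
    exact φ.injective.ne
      ((disjoint_region hp hv hγ hdisj).ne_of_mem (hcmem i j hij s) (hcmem k l hkl t))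

theorem IsPlanar.not_isMinor_K₅ (hG : IsPlanar G) : ¬ IsMinor K₅ G :=
  fun h => not_hasDisjointEdgeDrawing_K₅ (hG.hasDisjointEdgeDrawing h)

theorem IsPlanar.not_isMinor_K₃₃ (hG : IsPlanar G) : ¬ IsMinor K₃₃ G :=
  fun h => not_hasDisjointEdgeDrawing_K₃₃ (hG.hasDisjointEdgeDrawing h)

end Planar

section EdgeBound

open SimpleGraph

variable {W : Type*} {H : SimpleGraph W} {u v : W}

/-- The graph obtained from `H` by contracting the edge `uv`; the contracted edge is represented by
`u`, and `v` is removed. -/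
def contract (H : SimpleGraph W) (u v : W) : SimpleGraph ({v}ᶜ : Set W) :=
  (H ⊔ .fromRel fun a b => a = u ∧ H.Adj v b).induce {v}ᶜ

open Classical in
theorem isMinor_contract (huv : H.Adj u v) : IsMinor (contract H u v) H := by
  refine ⟨fun w => if w.1 = u then {u, v} else {w.1}, fun w => ?_, fun a b hab => ?_,
    fun a b hab => ?_⟩
  · by_cases hw : w.1 = u
    · beta_reduce
      rw [if_pos hw]
      exact induce_pair_connected_of_adj huv
    · beta_reduce
      rw [if_neg hw]
      exact connected_induce_singleton _
  · have hav : a.1 ≠ v := a.2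
    have hbv : b.1 ≠ v := b.2
    have hab : a.1 ≠ b.1 := Subtype.coe_ne_coe.2 hab
    dsimp only [Function.onFun]
    split_ifs <;> simp_all [eq_comm]
  · have mem_branch (w : ({v}ᶜ : Set W)) : w.1 ∈ if w.1 = u then ({u, v} : Set W) else {w.1} := by
      split_ifs with hw <;> simp [hw]
    obtain hab | ⟨-, ⟨ha, hvb⟩ | ⟨hb, hva⟩⟩ := hab
    · exact ⟨a, mem_branch a, b, mem_branch b, hab⟩
    · exact ⟨v, by simp_all, b, mem_branch b, hvb⟩
    · exact ⟨a, mem_branch a, v, by simp_all, hva.symm⟩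

open Classical in
theorem card_edgeFinset_induce_compl_singleton_eq_sub_degree [Fintype W] (H : SimpleGraph W)
    (v : W) : #(H.induce {v}ᶜ).edgeFinset = #H.edgeFinset - H.degree v := by
  rw [← card_edgeFinset_deleteIncidenceSet, ← card_edgeFinset_induce_compl_singleton]

open Classical in
-- Contracting an edge destroys that edge and one edge for each triangle containing it.
theorem card_edgeFinset_le_card_edgeFinset_contract [Fintype W] (huv : H.Adj u v) :
    #H.edgeFinset ≤
      #(contract H u v).edgeFinset + 1 + #{w ∈ H.neighborFinset v | H.Adj u w} := by
  set K : SimpleGraph W := H ⊔ .fromRel fun a b => a = u ∧ H.Adj v b with hK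
  set N : Finset W := {w ∈ H.neighborFinset v | w ≠ u ∧ ¬ H.Adj u w} with hN
  have degree_K : K.degree v = H.degree v := by
    simp only [← card_neighborFinset_eq_degree]
    congr 1
    ext w
    simp only [hK, mem_neighborFinset, sup_adj, fromRel_adj, huv.ne', H.irrefl]
    tauto
  have card_contract : #(contract H u v).edgeFinset = #K.edgeFinset - H.degree v := by
    rw [← degree_K]
    convert card_edgeFinset_induce_compl_singleton_eq_sub_degree K v
    rfl
  have degree_le : H.degree v ≤ #N + 1 + #{w ∈ H.neighborFinset v | H.Adj u w} := by
    have hsplit : H.neighborFinset v ⊆ insert u N ∪ {w ∈ H.neighborFinset v | H.Adj u w} := by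
      intro w hw
      simp only [hN, Finset.mem_union, Finset.mem_insert, Finset.mem_filter, hw]
      tauto
    calc H.degree v ≤ #(insert u N ∪ {w ∈ H.neighborFinset v | H.Adj u w}) :=
          Finset.card_le_card hsplit
      _ ≤ #(insert u N) + #{w ∈ H.neighborFinset v | H.Adj u w} := Finset.card_union_le _ _
      _ ≤ _ := by gcongr; exact Finset.card_insert_le _ _
  have card_le : #H.edgeFinset + #N ≤ #K.edgeFinset := by
    have hdisj : Disjoint H.edgeFinset (N.image (s(u, ·))) := by
      rw [Finset.disjoint_right, Finset.forall_mem_image]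
      simp +contextual [hN]
    rw [← Finset.card_image_of_injective N fun _ _ => Sym2.congr_right.1,
      ← Finset.card_union_of_disjoint hdisj]
    refine Finset.card_le_card (Finset.union_subset (edgeFinset_mono le_sup_left) ?_)
    simp +contextual [Finset.image_subset_iff, hN, hK, eq_comm]
  omega

open Classical in
theorem exists_le_card_edgeFinset_eq [Fintype W] [Fintype H.edgeSet] {m : ℕ}
    (hm : m ≤ #H.edgeFinset) : ∃ H' ≤ H, #H'.edgeFinset = m := by
  obtain ⟨s, hs, hcard⟩ := Finset.exists_subset_card_eq (Nat.sub_le #H.edgeFinset m)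
  refine ⟨H.deleteEdges s, H.deleteEdges_le s, ?_⟩
  rw [edgeFinset_deleteEdges, Finset.card_sdiff_of_subset hs]
  omega

theorem isMinor_K₅_of_card_neighbors_eq_five {N : Finset W} (hvN : ∀ u ∈ N, H.Adj v u)
    (hN : #N = 5) {a b : W} (ha : a ∈ N) (hb : b ∈ N) (hab : a ≠ b) (hnab : ¬ H.Adj a b)
    (hmatch : ∀ x ∈ N, ∀ y ∈ N, ∀ z ∈ N, x ≠ y → ¬ H.Adj x y → z ≠ x → z ≠ y → H.Adj x z) :
    IsMinor K₅ H := by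
  classical
  obtain ⟨c, d, e, hcd, hce, hR, hadj⟩ : ∃ c d e, c ≠ d ∧ c ≠ e ∧
      (N.erase a).erase b = {c, d, e} ∧ H.Adj d e := by
    have hR : #((N.erase a).erase b) = 3 := by
      rw [Finset.card_erase_of_mem (by simp [hab.symm, hb]), Finset.card_erase_of_mem ha, hN]
    obtain ⟨c, d, e, hcd, hce, hde, hR⟩ := Finset.card_eq_three.1 hR
    by_cases hadj : H.Adj d e
    · exact ⟨c, d, e, hcd, hce, hR, hadj⟩
    · have mem_N (w : W) (hw : w ∈ ({c, d, e} : Finset W)) : w ∈ N :=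
        Finset.mem_of_mem_erase (Finset.mem_of_mem_erase (hR ▸ hw))
      refine ⟨e, c, d, hce.symm, hde.symm, by grind, ?_⟩
      exact (hmatch d (mem_N d (by simp)) e (mem_N e (by simp)) c (mem_N c (by simp)) hde hadj
        hcd hce).symm
  have mem_R (w : W) : w ∈ ({c, d, e} : Finset W) ↔ w ≠ b ∧ w ≠ a ∧ w ∈ N := by
    rw [← hR, Finset.mem_erase, Finset.mem_erase]
  obtain ⟨hcb, hca, hcN⟩ := (mem_R c).1 (by simp)
  obtain ⟨hdb, hda, hdN⟩ := (mem_R d).1 (by simp)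
  obtain ⟨heb, hea, heN⟩ := (mem_R e).1 (by simp)
  have adj_a {w : W} (hw : w ∈ N) (hwa : w ≠ a) (hwb : w ≠ b) : H.Adj a w :=
    hmatch a ha b hb w hw hab hnab hwa hwb
  have adj_b {w : W} (hw : w ∈ N) (hwa : w ≠ a) (hwb : w ≠ b) : H.Adj b w :=
    hmatch b hb a ha w hw hab.symm (fun h => hnab h.symm) hwb hwa
  have triangle : H.IsNClique 3 {b, d, e} :=
    is3Clique_triple_iff.2 ⟨adj_b hdN hda hdb, adj_b heN hea heb, hadj⟩
  have triangle_subset : ∀ w ∈ ({b, d, e} : Finset W), w ∈ N := by simp [hb, hdN, heN]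
  refine isMinor_K₅_of_isNClique_four (S := {a, c})
    (triangle.insert fun w hw => hvN w (triangle_subset w hw))
    (induce_pair_connected_of_adj (adj_a hcN hca hcb)) ?_ ?_
  · have := (hvN a ha).ne
    have := (hvN c hcN).ne
    grind
  · simp only [Finset.mem_insert, Finset.mem_singleton, forall_eq_or_imp, forall_eq]
    exact ⟨⟨a, by simp, hvN a ha⟩, ⟨c, by simp, adj_b hcN hca hcb⟩,
      ⟨a, by simp, (adj_a hdN hda hdb).symm⟩, ⟨a, by simp, (adj_a heN hea heb).symm⟩⟩

open Classical in
theorem isMinor_K₅_of_card_neighbors_le_five {N : Finset W} (hvN : ∀ u ∈ N, H.Adj v u)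
    (hN₀ : N.Nonempty) (hN₅ : #N ≤ 5) (hdeg : ∀ u ∈ N, 3 ≤ #{w ∈ N | H.Adj u w}) :
    IsMinor K₅ H := by
  have card_nonadj (u : W) (hu : u ∈ N) : #{w ∈ N | w ≠ u ∧ ¬ H.Adj u w} + 4 ≤ #N := by
    have hsub : insert u {w ∈ N | H.Adj u w} ⊆ N \ {w ∈ N | w ≠ u ∧ ¬ H.Adj u w} := by
      grind
    have hle := Finset.card_le_card hsub
    rw [Finset.card_insert_of_notMem (by simp), Finset.card_sdiff_of_subset (by simp)] at hle
    have := hdeg u hu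
    omega
  by_cases hclique : H.IsClique (N : Set W)
  · obtain ⟨u, hu⟩ := hN₀
    obtain ⟨s, hsN, hs⟩ := Finset.exists_subset_card_eq (le_of_add_le_right (card_nonadj u hu))
    exact isMinor_K₅_of_isNClique_four ⟨hclique.subset (by exact_mod_cast hsN), hs⟩
      (connected_induce_singleton v) (fun x hx => (hvN x (hsN hx)).ne')
      fun x hx => ⟨v, rfl, (hvN x (hsN hx)).symm⟩
  · obtain ⟨a, ha, b, hb, hab, hnab⟩ : ∃ a ∈ N, ∃ b ∈ N, a ≠ b ∧ ¬ H.Adj a b := by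
      simpa [IsClique, Set.Pairwise] using hclique
    have hN : #N = 5 := by
      have := card_nonadj a ha
      have : 0 < #{w ∈ N | w ≠ a ∧ ¬ H.Adj a w} :=
        Finset.card_pos.2 ⟨b, by simp [hb, hab.symm, hnab]⟩
      omega
    refine isMinor_K₅_of_card_neighbors_eq_five hvN hN ha hb hab hnab
      fun x hx y hy z hz hxy hnxy hzx hzy => ?_
    by_contra hnxz
    have := card_nonadj x hx
    refine hzy (Finset.card_le_one.1 (show #{w ∈ N | w ≠ x ∧ ¬ H.Adj x w} ≤ 1 by omega) z ?_ y ?_)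
    all_goals simp_all [eq_comm]

theorem card_edgeFinset_add_five_le [Fintype W] [Fintype H.edgeSet] (hH : ¬ IsMinor K₅ H)
    (hW : 2 ≤ Fintype.card W) : #H.edgeFinset + 5 ≤ 3 * Fintype.card W := by
  classical
  induction hn : Fintype.card W generalizing W with
  | zero => omega
  | succ n ih =>
  obtain rfl | hn₂ : n = 1 ∨ 2 ≤ n := by omega
  · have := H.card_edgeFinset_le_card_choose_two
    rw [hn, Nat.choose_self] at this
    omega
  by_contra! hlt
  obtain ⟨H', hH'H, hE⟩ := exists_le_card_edgeFinset_eq (H := H) (m := 3 * n - 1) (by omega)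
  replace hH : ¬ IsMinor K₅ H' := fun h =>
    hH (h.trans (isMinor_of_isContained (.of_le hH'H)))
  have card_compl (v : W) : Fintype.card ({v}ᶜ : Set W) = n := by
    rw [Fintype.card_compl_set, hn, Set.card_singleton, Nat.add_sub_cancel]
  have triangles (u v : W) (huv : H'.Adj u v) : 3 ≤ #{w ∈ H'.neighborFinset v | H'.Adj u w} := by
    have h₁ := card_edgeFinset_le_card_edgeFinset_contract huv
    have h₂ := ih (H := contract H' u v) (fun h => hH (h.trans (isMinor_contract huv)))
      (by rwa [card_compl]) (card_compl v)
    omega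
  obtain ⟨v, hv⟩ : ∃ v, H'.degree v ≤ 5 := by
    by_contra! h
    have := Finset.card_nsmul_le_sum Finset.univ _ 6 fun v _ => h v
    rw [sum_degrees_eq_twice_card_edges, hE, Finset.card_univ, hn, smul_eq_mul] at this
    omega
  obtain hv₀ | hv₀ := (H'.neighborFinset v).eq_empty_or_nonempty
  · have h₁ : #(H'.induce {v}ᶜ).edgeFinset = #H'.edgeFinset := by
      rw [card_edgeFinset_induce_compl_singleton_eq_sub_degree,
        ← card_neighborFinset_eq_degree, hv₀, Finset.card_empty, Nat.sub_zero]
    have h₂ := ih (H := H'.induce {v}ᶜ)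
      (fun h => hH (h.trans (isMinor_of_isContained (Embedding.induce _).isContained)))
      (by rwa [card_compl]) (card_compl v)
    omega
  · exact hH (isMinor_K₅_of_card_neighbors_le_five (v := v) (by simp) hv₀ hv
      fun u hu => triangles u v ((H'.mem_neighborFinset v u).1 hu).symm)

end EdgeBound

section Degeneracy

open SimpleGraph

variable {V : Type*} {G : SimpleGraph V} [DecidableRel G.Adj] {S : Finset V}

theorem sum_card_neighbors_add_ten_le (hG : ¬ IsMinor K₅ G) (hS : 2 ≤ #S) :
    ∑ v ∈ S, #{w ∈ S | G.Adj v w} + 10 ≤ 6 * #S := by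
  classical
  have card_edges := card_edgeFinset_add_five_le (H := G.induce (S : Set V))
    (fun h => hG (h.trans (isMinor_of_isContained (Embedding.induce _).isContained)))
    (by simpa using hS)
  have degree_eq (v : S) : (G.induce (S : Set V)).degree v = #{w ∈ S | G.Adj v w} := by
    rw [← card_neighborFinset_eq_degree, neighborFinset_eq_filter, Finset.card_filter,
      Finset.card_filter, ← Finset.sum_coe_sort S]
    rfl
  have sum_degrees := sum_degrees_eq_twice_card_edges (G.induce (S : Set V))
  have sum_eq : ∑ v, (G.induce (S : Set V)).degree v = ∑ v ∈ S, #{w ∈ S | G.Adj v w} := by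
    rw [← Finset.sum_coe_sort S]
    exact Finset.sum_congr rfl fun v _ => degree_eq v
  simp only [Finset.coe_sort_coe, Fintype.card_coe] at card_edges
  omega

theorem exists_card_neighbors_le_five (hG : ¬ IsMinor K₅ G) (hS : S.Nonempty) :
    ∃ v ∈ S, #{w ∈ S | G.Adj v w} ≤ 5 := by
  by_contra! hlt
  obtain ⟨v, hv⟩ := hS
  have hcard : 2 ≤ #S := by
    have := (hlt v hv).trans_le (Finset.card_filter_le _ _)
    omega
  have hsum := sum_card_neighbors_add_ten_le hG hcard
  have := Finset.card_nsmul_le_sum S _ 6 hlt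
  rw [smul_eq_mul] at this
  omega

theorem exists_isIndepSet_card_le_mul {d : ℕ}
    (hS : ∀ T ⊆ S, T.Nonempty → ∃ v ∈ T, #{w ∈ T | G.Adj v w} ≤ d) :
    ∃ T ⊆ S, G.IsIndepSet (T : Set V) ∧ #S ≤ (d + 1) * #T := by
  classical
  induction S using Finset.strongInduction with
  | H S ih =>
  obtain rfl | hne := S.eq_empty_or_nonempty
  · exact ⟨∅, subset_rfl, by simp, by simp⟩
  obtain ⟨v, hv, hd⟩ := hS S subset_rfl hne
  have hsub : insert v {w ∈ S | G.Adj v w} ⊆ S :=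
    Finset.insert_subset hv (Finset.filter_subset _ _)
  obtain ⟨T, hTS, hT, hTcard⟩ := ih (S \ insert v {w ∈ S | G.Adj v w})
    (Finset.sdiff_ssubset hsub ⟨v, Finset.mem_insert_self _ _⟩)
    fun T' hT' => hS T' (hT'.trans Finset.sdiff_subset)
  have hvT : v ∉ T := fun h => by simpa using hTS h
  have hnadj (w : V) (hw : w ∈ T) : ¬ G.Adj v w := by
    have := hTS hw
    grind
  refine ⟨insert v T, Finset.insert_subset hv (hTS.trans Finset.sdiff_subset), ?_, ?_⟩
  · rw [Finset.coe_insert]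
    exact hT.insert fun w hw _ => ⟨hnadj w hw, fun h => hnadj w hw h.symm⟩
  · have hsplit := Finset.card_sdiff_add_card_eq_card hsub
    have := Finset.card_insert_le v {w ∈ S | G.Adj v w}
    rw [Finset.card_insert_of_notMem hvT]
    linarith

theorem sum_card_neighbors_add_le_of_le_card_neighbors (hG : ¬ IsMinor K₅ G) {X W : Finset V}
    {d : ℕ} (hX : 2 ≤ #X) (hdisj : Disjoint X W) (hd : ∀ w ∈ W, d ≤ #{x ∈ X | G.Adj w x}) :
    ∑ v ∈ W, #{w ∈ W | G.Adj v w} + 2 * d * #W + 10 ≤ 6 * (#X + #W) := by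
  classical
  have htotal := sum_card_neighbors_add_ten_le hG
    (hX.trans (Finset.card_le_card (Finset.subset_union_left (s₂ := W))))
  rw [Finset.card_union_of_disjoint hdisj, Finset.sum_union hdisj] at htotal
  have hW : ∑ v ∈ W, #{w ∈ W | G.Adj v w} + d * #W ≤ ∑ v ∈ W, #{w ∈ X ∪ W | G.Adj v w} := by
    rw [mul_comm d, ← smul_eq_mul, ← Finset.sum_const, ← Finset.sum_add_distrib]
    refine Finset.sum_le_sum fun w hw => ?_
    rw [Finset.filter_union, Finset.card_union_of_disjoint (Finset.disjoint_filter_filter hdisj),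
      add_comm]
    gcongr
    exact hd w hw
  have hX : d * #W ≤ ∑ x ∈ X, #{w ∈ X ∪ W | G.Adj x w} := calc
    d * #W ≤ ∑ w ∈ W, #{x ∈ X | G.Adj x w} := by
      rw [mul_comm, ← smul_eq_mul]
      refine Finset.card_nsmul_le_sum _ _ _ fun w hw => ?_
      simpa only [G.adj_comm _ w] using hd w hw
    _ = ∑ x ∈ X, #{w ∈ W | G.Adj x w} :=
      (Finset.sum_card_bipartiteAbove_eq_sum_card_bipartiteBelow G.Adj).symm
    _ ≤ ∑ x ∈ X, #{w ∈ X ∪ W | G.Adj x w} := by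
      gcongr
      exact Finset.subset_union_right
  linarith

end Degeneracy

section TwoClasses

open SimpleGraph

variable {V : Type*} [Fintype V] [DecidableEq V] {G : SimpleGraph V} [DecidableRel G.Adj]
  {X Y Y' : Finset V} {v x : V}

theorem mem_projClass : v ∈ projClass G X Y ↔ v ∉ X ∧ {x ∈ X | G.Adj v x} = Y :=
  Finset.mem_filter_univ v

theorem adj_of_mem_projClass (hv : v ∈ projClass G X Y) (hx : x ∈ Y) : G.Adj v x := by
  rw [← (mem_projClass.1 hv).2] at hx
  exact (Finset.mem_filter.1 hx).2

theorem eq_of_mem_projClass (hv : v ∈ projClass G X Y) (hv' : v ∈ projClass G X Y') : Y = Y' :=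
  (mem_projClass.1 hv).2.symm.trans (mem_projClass.1 hv').2

theorem mem_twoClassVertices :
    v ∈ twoClassVertices G X ↔ v ∉ X ∧ #{x ∈ X | G.Adj v x} = 2 := by
  simp only [twoClassVertices, Finset.mem_biUnion, Finset.mem_powersetCard, mem_projClass]
  constructor
  · rintro ⟨Y, ⟨-, hY⟩, hv, rfl⟩
    exact ⟨hv, hY⟩
  · rintro ⟨hv, hcard⟩
    exact ⟨_, ⟨Finset.filter_subset _ _, hcard⟩, hv, rfl⟩

theorem mem_twoClassVertices_of_mem_projClass (hY : #Y = 2) (hv : v ∈ projClass G X Y) :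
    v ∈ twoClassVertices G X := by
  obtain ⟨hvX, rfl⟩ := mem_projClass.1 hv
  exact mem_twoClassVertices.2 ⟨hvX, hY⟩

variable (G X) in
/-- The graph on `X` whose edges are the pairs of key vertices of the nonempty 2-classes. -/
def keyGraph : SimpleGraph X where
  Adj x y := x ≠ y ∧ (projClass G X {x.1, y.1}).Nonempty
  symm := ⟨fun x y h => ⟨h.1.symm, by rw [Finset.pair_comm]; exact h.2⟩⟩
  loopless := ⟨fun _ h => h.1 rfl⟩

-- Contract every vertex of a 2-class into one of its key vertices.
theorem isMinor_keyGraph : IsMinor (keyGraph G X) G := by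
  have exists_key (v : V) (hv : v ∈ twoClassVertices G X) : ∃ x : X, G.Adj v x := by
    obtain ⟨x, hx⟩ := Finset.card_pos.1 ((mem_twoClassVertices.1 hv).2 ▸ two_pos)
    exact ⟨⟨x, (Finset.mem_filter.1 hx).1⟩, (Finset.mem_filter.1 hx).2⟩
  choose key hkey using exists_key
  refine ⟨fun x => insert x.1 {v | ∃ hv, key v hv = x}, fun x => ?_, fun x y hxy => ?_, ?_⟩
  · refine connected_induce_insert ?_
    rintro v ⟨hv, rfl⟩
    exact (hkey v hv).symm
  · refine Set.disjoint_left.2 ?_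
    rintro v (rfl | ⟨hv, rfl⟩) (h | ⟨hv', h⟩)
    · exact hxy (Subtype.ext h)
    · exact (mem_twoClassVertices.1 hv').1 x.2
    · exact (mem_twoClassVertices.1 hv).1 (h ▸ y.2)
    · exact hxy h
  · rintro x y ⟨hxy, v, hv⟩
    have hvC := mem_twoClassVertices_of_mem_projClass
      (Finset.card_pair (Subtype.coe_ne_coe.2 hxy)) hv
    have key_mem : (key v hvC).1 ∈ ({x.1, y.1} : Finset V) := by
      rw [← (mem_projClass.1 hv).2]
      exact Finset.mem_filter.2 ⟨(key v hvC).2, hkey v hvC⟩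
    rw [Finset.mem_insert, Finset.mem_singleton] at key_mem
    obtain hx | hy := key_mem.imp Subtype.ext Subtype.ext
    · exact ⟨v, .inr ⟨hvC, hx⟩, y, .inl rfl, adj_of_mem_projClass hv (by simp)⟩
    · exact ⟨x, .inl rfl, v, .inr ⟨hvC, hy⟩, (adj_of_mem_projClass hv (by simp)).symm⟩

theorem card_nonempty_twoClasses_add_five_le (hG : ¬ IsMinor K₅ G) (hX : 2 ≤ #X) :
    #{Y ∈ X.powersetCard 2 | (projClass G X Y).Nonempty} + 5 ≤ 3 * #X := by
  classical
  have hsub : {Y ∈ X.powersetCard 2 | (projClass G X Y).Nonempty} ⊆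
      (keyGraph G X).edgeFinset.image fun e => (e.map Subtype.val).toFinset := by
    intro Y hY
    obtain ⟨hY, hne⟩ := Finset.mem_filter.1 hY
    obtain ⟨hYX, hYcard⟩ := Finset.mem_powersetCard.1 hY
    obtain ⟨x, y, hxy, rfl⟩ := Finset.card_eq_two.1 hYcard
    have hx : x ∈ X := hYX (by simp)
    have hy : y ∈ X := hYX (by simp)
    refine Finset.mem_image.2 ⟨s(⟨x, hx⟩, ⟨y, hy⟩), ?_, Sym2.toFinset_mk_eq⟩
    exact mem_edgeFinset.2 ⟨fun h => hxy (congrArg Subtype.val h), hne⟩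
  have card_edges := card_edgeFinset_add_five_le (H := keyGraph G X)
    (fun h => hG (h.trans isMinor_keyGraph)) (by rwa [Fintype.card_coe])
  rw [Fintype.card_coe] at card_edges
  have := (Finset.card_le_card hsub).trans Finset.card_image_le
  omega

end TwoClasses

section CommonNeighbors

open SimpleGraph

variable {V : Type*} {G : SimpleGraph V} {x y z : V} {C C' T : Finset V}

theorem isIndepSet_union {S T : Set V} (hS : G.IsIndepSet S) (hT : G.IsIndepSet T)
    (hST : ∀ s ∈ S, ∀ t ∈ T, ¬ G.Adj s t) : G.IsIndepSet (S ∪ T) := by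
  rintro s (hs | hs) t (ht | ht) hst
  · exact hS hs ht hst
  · exact hST s hs t ht
  · exact fun hadj => hST t ht s hs hadj.symm
  · exact hT hs ht hst

theorem isIndepSet_pair {a b : V} (hab : ¬ G.Adj a b) : G.IsIndepSet {a, b} :=
  (Set.pairwise_singleton b _).insert fun _ hc _ =>
    Set.mem_singleton_iff.1 hc ▸ ⟨hab, fun hba => hab hba.symm⟩

-- A triangle in `C` spans a clique with `x`, and every vertex of this clique has a neighbour in
-- `{y, c}` for a fourth vertex `c` of `C`.
theorem not_isNClique_three_of_common_neighbors (hG : ¬ IsMinor K₅ G) (hxy : x ≠ y)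
    (hCx : ∀ c ∈ C, G.Adj x c) (hCy : ∀ c ∈ C, G.Adj y c) (hC : 4 ≤ #C) (hTC : T ⊆ C) :
    ¬ G.IsNClique 3 T := by
  classical
  intro hT
  obtain ⟨c, hc, hcT⟩ := Finset.exists_mem_notMem_of_card_lt_card
    (show #T < #C by rw [hT.card_eq]; omega)
  refine hG (isMinor_K₅_of_isNClique_four (S := {y, c}) (hT.insert fun t ht => hCx t (hTC ht))
    (induce_pair_connected_of_adj (hCy c hc)) ?_ ?_)
  · simp only [Finset.mem_insert, Set.mem_insert_iff, Set.mem_singleton_iff, not_or]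
    rintro t (rfl | ht)
    · exact ⟨hxy, (hCx c hc).ne⟩
    · exact ⟨(hCy t (hTC ht)).ne', ne_of_mem_of_not_mem ht hcT⟩
  · intro t ht
    obtain rfl | ht := Finset.mem_insert.1 ht
    · exact ⟨c, by simp, hCx c hc⟩
    · exact ⟨y, by simp, (hCy t (hTC ht)).symm⟩

theorem exists_isIndepSet_card_two_of_common_neighbors (hG : ¬ IsMinor K₅ G) (hxy : x ≠ y)
    (hCx : ∀ c ∈ C, G.Adj x c) (hCy : ∀ c ∈ C, G.Adj y c) (hC : 4 ≤ #C) (hTC : T ⊆ C)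
    (hT : 3 ≤ #T) : ∃ P ⊆ T, #P = 2 ∧ G.IsIndepSet (P : Set V) := by
  classical
  obtain ⟨U, hUT, hU⟩ := Finset.exists_subset_card_eq hT
  have hclique : ¬ G.IsClique (U : Set V) := fun h =>
    not_isNClique_three_of_common_neighbors hG hxy hCx hCy hC (hUT.trans hTC) ⟨h, hU⟩
  obtain ⟨a, ha, b, hb, hab, hnab⟩ : ∃ a ∈ U, ∃ b ∈ U, a ≠ b ∧ ¬ G.Adj a b := by
    simpa [IsClique, Set.Pairwise] using hclique
  refine ⟨{a, b}, ?_, Finset.card_pair hab, by simpa using isIndepSet_pair hnab⟩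
  simp [Finset.insert_subset_iff, hUT ha, hUT hb]

theorem exists_isIndepSet_card_three_of_common_neighbors (hG : ¬ IsMinor K₅ G) (hxy : x ≠ y)
    (hCx : ∀ c ∈ C, G.Adj x c) (hCy : ∀ c ∈ C, G.Adj y c) (hC : 6 ≤ #C) :
    ∃ T ⊆ C, #T = 3 ∧ G.IsIndepSet (T : Set V) := by
  classical
  obtain ⟨v, hv⟩ : C.Nonempty := Finset.card_pos.1 (by omega)
  have hsplit := Finset.card_filter_add_card_filter_not (s := C.erase v) fun w => G.Adj v w
  rw [Finset.card_erase_of_mem hv] at hsplit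
  by_cases hdeg : 3 ≤ #{w ∈ C.erase v | G.Adj v w}
  · obtain ⟨T, hTsub, hT⟩ := Finset.exists_subset_card_eq hdeg
    simp only [Finset.subset_iff, Finset.mem_filter, Finset.mem_erase] at hTsub
    refine ⟨T, fun w hw => (hTsub hw).1.2, hT, fun a ha b hb _ hadj => ?_⟩
    refine not_isNClique_three_of_common_neighbors hG hxy hCx hCy (by omega) (T := {v, a, b}) ?_
      (is3Clique_triple_iff.2 ⟨(hTsub ha).2, (hTsub hb).2, hadj⟩)
    simp [Finset.insert_subset_iff, hv, (hTsub ha).1.2, (hTsub hb).1.2]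
  · obtain ⟨P, hPsub, hPcard, hP⟩ := exists_isIndepSet_card_two_of_common_neighbors hG hxy hCx hCy
      (by omega) (T := {w ∈ C.erase v | ¬ G.Adj v w})
      ((Finset.filter_subset _ _).trans (Finset.erase_subset _ _)) (by omega)
    simp only [Finset.subset_iff, Finset.mem_filter, Finset.mem_erase] at hPsub
    refine ⟨insert v P, Finset.insert_subset hv fun w hw => (hPsub hw).1.2, ?_, ?_⟩
    · rw [Finset.card_insert_of_notMem fun h => (hPsub h).1.1 rfl, hPcard]
    · rw [Finset.coe_insert]
      exact hP.insert fun w hw _ => ⟨(hPsub hw).2, fun h => (hPsub hw).2 h.symm⟩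

/-- `C` and `C'` are disjoint sets of common neighbours of `x, y` and of `x, z`, positioned like two
2-classes with the common key vertex `x`. -/
structure IsWedge (G : SimpleGraph V) (x y z : V) (C C' : Finset V) : Prop where
  ne_left : x ≠ y
  ne_right : x ≠ z
  ne_ends : y ≠ z
  disjoint : Disjoint C C'
  adj_apex : ∀ c ∈ C, G.Adj x c
  adj_apex' : ∀ c ∈ C', G.Adj x c
  adj_left : ∀ c ∈ C, G.Adj y c
  adj_right : ∀ c ∈ C', G.Adj z c
  left_notMem : y ∉ C'
  right_notMem : z ∉ C

theorem IsWedge.symm (h : IsWedge G x y z C C') : IsWedge G x z y C' C :=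
  ⟨h.ne_right, h.ne_left, h.ne_ends.symm, h.disjoint.symm, h.adj_apex', h.adj_apex, h.adj_right,
    h.adj_left, h.right_notMem, h.left_notMem⟩

-- Otherwise every vertex of `C` except `a` is adjacent to `x`, to `y` and to the connected set
-- consisting of `a`, `z` and `C'`.
theorem IsWedge.exists_not_adj_of_adj (h : IsWedge G x y z C C') (hG : ¬ IsMinor K₃₃ G)
    (hC : 4 ≤ #C) {a a' : V} (ha : a ∈ C) (ha' : a' ∈ C') (hadj : G.Adj a a') :
    ∃ b ∈ C, b ≠ a ∧ ¬ G.Adj a b ∧ ∀ c' ∈ C', ¬ G.Adj b c' := by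
  classical
  by_contra! hall
  have hS : (G.induce ({a} ∪ insert z (C' : Set V))).Connected :=
    connected_induce_union (connected_induce_singleton a).preconnected
      (connected_induce_insert h.adj_right).preconnected rfl (.inr ha') hadj
  refine hG (isMinor_K₃₃_of_common_neighbors (T := C.erase a) h.ne_left hS ?_ ?_ ?_ ?_
    (fun t ht => h.adj_apex t (Finset.mem_of_mem_erase ht))
    (fun t ht => h.adj_left t (Finset.mem_of_mem_erase ht)) ?_)
  · rintro (hxa | hxz | hxC')
    exacts [(h.adj_apex a ha).ne hxa, h.ne_right hxz, G.irrefl (h.adj_apex' x hxC')]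
  · rintro (hya | hyz | hyC')
    exacts [(h.adj_left a ha).ne hya, h.ne_ends hyz, h.left_notMem hyC']
  · rw [Finset.card_erase_of_mem ha]
    omega
  · rintro t ht (hta | rfl | htC')
    exacts [Finset.ne_of_mem_erase ht hta, h.right_notMem (Finset.mem_of_mem_erase ht),
      Finset.disjoint_left.1 h.disjoint (Finset.mem_of_mem_erase ht) htC']
  · intro t ht
    by_cases hat : G.Adj a t
    · exact ⟨a, .inl rfl, hat⟩
    · obtain ⟨c', hc', htc'⟩ := hall t (Finset.mem_of_mem_erase ht) (Finset.ne_of_mem_erase ht) hat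
      exact ⟨c', .inr (.inr hc'), htc'.symm⟩

-- Otherwise `a` and `b` in `A`, together with `z`, are adjacent to two vertices of `A'` and to the
-- connected set `{x, c}` for a third vertex `c` of `C'`.
theorem IsWedge.exists_not_adj (h : IsWedge G x y z C C') (hG : ¬ IsMinor K₃₃ G) (hC' : 3 ≤ #C')
    {A A' : Finset V} (hAC : A ⊆ C) (hAC' : A' ⊆ C') (hA : 2 ≤ #A) (hA' : 2 ≤ #A') :
    ∃ a ∈ A, ∃ a' ∈ A', ¬ G.Adj a a' := by
  classical
  by_contra! hall
  obtain ⟨B, hBA, hB⟩ := Finset.exists_subset_card_eq hA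
  obtain ⟨B', hBA', hB'⟩ := Finset.exists_subset_card_eq hA'
  obtain ⟨c, hc, hcB'⟩ := Finset.exists_mem_notMem_of_card_lt_card (show #B' < #C' by omega)
  obtain ⟨u, v, huv, rfl⟩ := Finset.card_eq_two.1 hB'
  have hu : u ∈ A' := hBA' (by simp)
  have hv : v ∈ A' := hBA' (by simp)
  simp only [Finset.mem_insert, Finset.mem_singleton, not_or] at hcB'
  have hzB : z ∉ B := fun hz => h.right_notMem (hAC (hBA hz))
  refine hG (isMinor_K₃₃_of_common_neighbors (T := insert z B) (S := {x, c}) huv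
    (induce_pair_connected_of_adj (h.adj_apex' c hc)) ?_ ?_ ?_ ?_ ?_ ?_ ?_)
  · simpa using ⟨(h.adj_apex' u (hAC' hu)).ne', Ne.symm hcB'.1⟩
  · simpa using ⟨(h.adj_apex' v (hAC' hv)).ne', Ne.symm hcB'.2⟩
  · rw [Finset.card_insert_of_notMem hzB, hB]
  · rw [Finset.forall_mem_insert]
    refine ⟨by simpa using ⟨h.ne_right.symm, (h.adj_right c hc).ne⟩, fun b hb => ?_⟩
    simpa using ⟨(h.adj_apex b (hAC (hBA hb))).ne',
      fun hbc => Finset.disjoint_left.1 h.disjoint (hAC (hBA hb)) (hbc ▸ hc)⟩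
  · rw [Finset.forall_mem_insert]
    exact ⟨(h.adj_right u (hAC' hu)).symm, fun b hb => (hall b (hBA hb) u hu).symm⟩
  · rw [Finset.forall_mem_insert]
    exact ⟨(h.adj_right v (hAC' hv)).symm, fun b hb => (hall b (hBA hb) v hv).symm⟩
  · rw [Finset.forall_mem_insert]
    exact ⟨⟨c, by simp, (h.adj_right c hc).symm⟩,
      fun b hb => ⟨x, by simp, h.adj_apex b (hAC (hBA hb))⟩⟩

open Classical in
theorem IsWedge.exists_isIndepSet_union_of_card_le_one (h : IsWedge G x y z C C')
    (hG : ¬ IsMinor K₅ G) (hC : 4 ≤ #C) (hC' : 4 ≤ #C')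
    (hA : #{a ∈ C | ∃ a' ∈ C', G.Adj a a'} ≤ 1) :
    ∃ P ⊆ C, ∃ P' ⊆ C', #P = 2 ∧ #P' = 2 ∧ G.IsIndepSet (P ∪ P' : Set V) := by
  have hsplit := Finset.card_filter_add_card_filter_not (s := C) fun a => ∃ a' ∈ C', G.Adj a a'
  obtain ⟨P, hPC, hP, hPindep⟩ := exists_isIndepSet_card_two_of_common_neighbors hG h.ne_left
    h.adj_apex h.adj_left hC (Finset.filter_subset (fun a => ¬ ∃ a' ∈ C', G.Adj a a') C) (by omega)
  obtain ⟨P', hPC', hP', hPindep'⟩ := exists_isIndepSet_card_two_of_common_neighbors hG h.ne_right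
    h.adj_apex' h.adj_right hC' subset_rfl (by omega)
  refine ⟨P, hPC.trans (Finset.filter_subset _ _), P', hPC', hP, hP',
    isIndepSet_union hPindep hPindep' fun a ha a' ha' hadj => ?_⟩
  exact (Finset.mem_filter.1 (hPC ha)).2 ⟨a', hPC' ha', hadj⟩

theorem IsWedge.exists_isIndepSet_union (h : IsWedge G x y z C C') (hG : ¬ IsMinor K₅ G)
    (hG' : ¬ IsMinor K₃₃ G) (hC : 4 ≤ #C) (hC' : 4 ≤ #C') :
    ∃ P ⊆ C, ∃ P' ⊆ C', #P = 2 ∧ #P' = 2 ∧ G.IsIndepSet (P ∪ P' : Set V) := by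
  classical
  by_cases hA : #{a ∈ C | ∃ a' ∈ C', G.Adj a a'} ≤ 1
  · exact h.exists_isIndepSet_union_of_card_le_one hG hC hC' hA
  by_cases hA' : #{a' ∈ C' | ∃ a ∈ C, G.Adj a' a} ≤ 1
  · obtain ⟨P', hPC', P, hPC, hP', hP, hindep⟩ :=
      h.symm.exists_isIndepSet_union_of_card_le_one hG hC' hC hA'
    exact ⟨P, hPC, P', hPC', hP, hP', Set.union_comm _ _ ▸ hindep⟩
  obtain ⟨a, ha, a', ha', haa'⟩ := h.exists_not_adj hG' (by omega) (Finset.filter_subset _ C)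
    (Finset.filter_subset _ C') (not_le.1 hA) (not_le.1 hA')
  obtain ⟨ha, c', hc', hac'⟩ := Finset.mem_filter.1 ha
  obtain ⟨ha', c, hc, hca'⟩ := Finset.mem_filter.1 ha'
  obtain ⟨b, hb, hba, hnab, hbC'⟩ := h.exists_not_adj_of_adj hG' hC ha hc' hac'
  obtain ⟨b', hb', hba', hnab', hbC⟩ := h.symm.exists_not_adj_of_adj hG' hC' ha' hc hca'
  refine ⟨{a, b}, by simp [Finset.insert_subset_iff, ha, hb], {a', b'},
    by simp [Finset.insert_subset_iff, ha', hb'], Finset.card_pair hba.symm,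
    Finset.card_pair hba'.symm, ?_⟩
  simp only [Finset.coe_insert, Finset.coe_singleton]
  refine isIndepSet_union (isIndepSet_pair hnab) (isIndepSet_pair hnab') ?_
  rintro _ (rfl | rfl) _ (rfl | rfl)
  exacts [haa', fun hadj => hbC _ ha hadj.symm, hbC' _ ha', hbC' _ hb']

end CommonNeighbors

section GreedyOrder

open SimpleGraph

theorem exists_injective_forall_mem_of_lt_card {V : Type*} {k : ℕ} {F : Fin k → Finset V}
    (hF : ∀ t : Fin k, (t : ℕ) < #(F t)) :
    ∃ j : Fin k → V, Function.Injective j ∧ ∀ t, j t ∈ F t := by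
  classical
  refine (Finset.all_card_le_biUnion_card_iff_exists_injective F).1 fun S => ?_
  obtain rfl | hS := S.eq_empty_or_nonempty
  · simp
  calc #S ≤ #(Finset.Iic (S.max' hS)) :=
        Finset.card_le_card fun t ht => Finset.mem_Iic.2 (S.le_max' t ht)
    _ ≤ #(F (S.max' hS)) := by rw [Fin.card_Iic]; exact hF _
    _ ≤ #(S.biUnion F) := Finset.card_le_card (Finset.subset_biUnion_of_mem F (S.max'_mem hS))

theorem exists_injective_zero_one_forall_mem {V : Type*} {k : ℕ} (hk : 2 ≤ k)
    {F : Fin k → Finset V} {a b : V} (hab : a ≠ b)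
    (hF : ∀ t : Fin k, 2 ≤ (t : ℕ) → (t : ℕ) < #(F t)) :
    ∃ j : Fin k → V, Function.Injective j ∧ j ⟨0, by omega⟩ = a ∧ j ⟨1, hk⟩ = b ∧
      ∀ t : Fin k, 2 ≤ (t : ℕ) → j t ∈ F t := by
  classical
  let F' (t : Fin k) : Finset V :=
    if (t : ℕ) = 0 then {a} else if (t : ℕ) = 1 then {a, b} else F t
  have hF' (t : Fin k) : (t : ℕ) < #(F' t) := by
    dsimp only [F']
    split_ifs with h₀ h₁
    · simp [h₀]
    · rw [Finset.card_pair hab, h₁]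
      exact one_lt_two
    · exact hF t (by omega)
  obtain ⟨j, hj, hjF⟩ := exists_injective_forall_mem_of_lt_card hF'
  have j_zero : j ⟨0, by omega⟩ = a := by simpa [F'] using hjF ⟨0, by omega⟩
  have j_one : j ⟨1, hk⟩ = a ∨ j ⟨1, hk⟩ = b := by simpa [F'] using hjF ⟨1, hk⟩
  refine ⟨j, hj, j_zero, j_one.resolve_left fun h => ?_, fun t ht => ?_⟩
  · simpa using hj (h.trans j_zero.symm)
  · simpa [F', show (t : ℕ) ≠ 0 by omega, show (t : ℕ) ≠ 1 by omega] using hjF t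

variable {V : Type*} [DecidableEq V] {G : SimpleGraph V} [DecidableRel G.Adj]
  {J I S S₀ T Z : Finset V} {a b v w : V}

/-- The vertices of `I` all of whose neighbours in `J` lie in `S`: those onto which a token may move
once the tokens have left `S`. -/
def settled (G : SimpleGraph V) [DecidableRel G.Adj] (J I S : Finset V) : Finset V :=
  {v ∈ I | ∀ u ∈ J, G.Adj v u → u ∈ S}

theorem mem_settled : v ∈ settled G J I S ↔ v ∈ I ∧ ∀ u ∈ J, G.Adj v u → u ∈ S :=
  Finset.mem_filter

theorem settled_mono (hST : S ⊆ T) : settled G J I S ⊆ settled G J I T := fun _ hv =>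
  mem_settled.2 ((mem_settled.1 hv).imp_right fun h u hu huv => hST (h u hu huv))

theorem settled_self : settled G J I J = I :=
  Finset.filter_true_of_mem fun _ _ _ hu _ => hu

theorem card_settled_erase (hw : w ∈ J) :
    #(settled G J I (S.erase w)) + #{v ∈ settled G J I S | G.Adj v w} = #(settled G J I S) := by
  rw [← Finset.card_filter_add_card_filter_not (s := settled G J I S) fun v => G.Adj v w, add_comm]
  congr 2
  ext v
  simp only [mem_settled, Finset.mem_filter, Finset.mem_erase]
  grind

theorem sum_card_settled_adj_le {d : ℕ} (hd : ∀ v ∈ I, #{u ∈ J | G.Adj v u} ≤ d) (hS : S ⊆ J) :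
    ∑ w ∈ S \ S₀, #{v ∈ settled G J I S | G.Adj v w} ≤
      #(settled G J I S \ settled G J I S₀) * min d #(S \ S₀) := by
  calc ∑ w ∈ S \ S₀, #{v ∈ settled G J I S | G.Adj v w}
      = ∑ v ∈ settled G J I S, #{w ∈ S \ S₀ | G.Adj v w} :=
        Finset.sum_card_bipartiteAbove_eq_sum_card_bipartiteBelow fun w v => G.Adj v w
    _ = ∑ v ∈ settled G J I S \ settled G J I S₀, #{w ∈ S \ S₀ | G.Adj v w} := by
        refine (Finset.sum_subset Finset.sdiff_subset fun v hv hv₀ => ?_).symm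
        have hv₀ : v ∈ settled G J I S₀ := by simpa [hv] using hv₀
        refine Finset.card_eq_zero.2 (Finset.filter_eq_empty_iff.2 fun w hw hvw => ?_)
        have hw := Finset.mem_sdiff.1 hw
        exact hw.2 ((mem_settled.1 hv₀).2 w (hS hw.1) hvw)
    _ ≤ #(settled G J I S \ settled G J I S₀) * min d #(S \ S₀) := by
        refine Finset.sum_le_card_nsmul _ _ _ fun v hv => le_min ?_ (Finset.card_filter_le _ _)
        refine (Finset.card_le_card (Finset.filter_subset_filter _ ?_)).trans
          (hd v (mem_settled.1 (Finset.mem_sdiff.1 hv).1).1)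
        exact Finset.sdiff_subset.trans hS

-- If every `w` failed, each would have at least `#(settled G J I S) - #S + 2` neighbours among the
-- settled vertices, which contradicts a double count since these have at most two neighbours in `J`
-- and `S₀` has a surplus.
theorem exists_card_le_card_settled_erase (hdeg : ∀ v ∈ I, #{u ∈ J | G.Adj v u} ≤ 2)
    (hS₀ : S₀ ⊂ S) (hS : S ⊆ J) (hsurplus : #S₀ < #(settled G J I S₀))
    (hcard : #S ≤ #(settled G J I S)) :
    ∃ w ∈ S \ S₀, #(S.erase w) ≤ #(settled G J I (S.erase w)) := by
  by_contra! hlt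
  obtain ⟨σ, hσ⟩ := Nat.exists_eq_add_of_le hcard
  have hlower : #(S \ S₀) * (σ + 2) ≤ ∑ w ∈ S \ S₀, #{v ∈ settled G J I S | G.Adj v w} := by
    refine Finset.card_nsmul_le_sum (S \ S₀) _ (σ + 2) fun w hw => ?_
    have hwS := (Finset.mem_sdiff.1 hw).1
    have h₁ := card_settled_erase (G := G) (I := I) (S := S) (hS hwS)
    have h₂ := hlt w hw
    rw [Finset.card_erase_of_mem hwS] at h₂
    omega
  have hupper := sum_card_settled_adj_le (S₀ := S₀) hdeg hS
  have hsettled := Finset.card_sdiff_add_card_eq_card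
    (settled_mono (G := G) (J := J) (I := I) hS₀.subset)
  have hdiff := Finset.card_sdiff_add_card_eq_card hS₀.subset
  have hle : #(settled G J I S \ settled G J I S₀) + 1 ≤ #(S \ S₀) + σ := by omega
  have hpos : 0 < #(S \ S₀) := Finset.card_pos.2 (Finset.sdiff_nonempty.2 hS₀.not_subset)
  obtain hone | htwo : #(S \ S₀) = 1 ∨ 2 ≤ #(S \ S₀) := by omega
  · rw [hone, min_eq_right one_le_two] at hupper
    rw [hone] at hlower hle
    omega
  · rw [min_eq_left htwo] at hupper
    nlinarith

/-- `S` can be enumerated as a list such that, from the second entry on, every initial segment has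
at least as many settled vertices as entries, and such that `Z` is among the first two entries. -/
def HasSettlingOrder (G : SimpleGraph V) [DecidableRel G.Adj] (J I Z S : Finset V) : Prop :=
  ∃ l : List V, l.Nodup ∧ l.toFinset = S ∧ Z ⊆ (l.take 2).toFinset ∧
    ∀ t, 2 ≤ t → t ≤ l.length → t ≤ #(settled G J I (l.take t).toFinset)

theorem hasSettlingOrder_self (hZ : #Z ≤ 2) (hsettled : #Z ≤ #(settled G J I Z)) :
    HasSettlingOrder G J I Z Z := by
  have hlen : Z.toList.length ≤ 2 := by simpa using hZ
  refine ⟨Z.toList, Z.nodup_toList, Z.toList_toFinset, ?_, fun t ht htlen => ?_⟩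
  · rw [List.take_of_length_le hlen, Finset.toList_toFinset]
  · rw [List.take_of_length_le (hlen.trans ht), Finset.toList_toFinset]
    exact htlen.trans (by rwa [Finset.length_toList])

theorem HasSettlingOrder.insert (h : HasSettlingOrder G J I Z S) (hw : w ∉ S)
    (hsettled : #(insert w S) ≤ #(settled G J I (insert w S))) :
    HasSettlingOrder G J I Z (insert w S) := by
  obtain ⟨l, hl, rfl, hZ, hseg⟩ := h
  have hwl : w ∉ l := fun h => hw (List.mem_toFinset.2 h)
  have hlw : (l ++ [w]).toFinset = Insert.insert w l.toFinset := by
    rw [List.toFinset_append, Finset.union_comm]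
    rfl
  refine ⟨l ++ [w], List.nodup_append_comm.1 (List.nodup_cons.2 ⟨hwl, hl⟩), hlw, ?_, ?_⟩
  · refine hZ.trans fun x hx => List.mem_toFinset.2 ?_
    exact ((List.prefix_append l [w]).take 2).subset (List.mem_toFinset.1 hx)
  · intro t ht htlen
    obtain htl | htl := Nat.lt_or_ge l.length t
    · rw [List.take_of_length_le (by simpa using htl), hlw]
      rw [Finset.card_insert_of_notMem hw, List.toFinset_card_of_nodup hl] at hsettled
      exact htlen.trans (by simpa using hsettled)
    · rw [List.take_append_of_le_length htl]
      exact hseg t ht htl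

theorem hasSettlingOrder_of_surplus (hdeg : ∀ v ∈ I, #{u ∈ J | G.Adj v u} ≤ 2)
    (hS₀ : S₀ ⊆ S) (hS : S ⊆ J) (hsurplus : #S₀ < #(settled G J I S₀))
    (hcard : #S ≤ #(settled G J I S)) (horder : HasSettlingOrder G J I Z S₀) :
    HasSettlingOrder G J I Z S := by
  induction S using Finset.strongInduction with
  | H S ih =>
  obtain rfl | hss := hS₀.eq_or_ssubset
  · exact horder
  obtain ⟨w, hw, hwcard⟩ := exists_card_le_card_settled_erase hdeg hss hS hsurplus hcard
  obtain ⟨hwS, hwS₀⟩ := Finset.mem_sdiff.1 hw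
  have herase := ih (S.erase w) (Finset.erase_ssubset hwS) (Finset.subset_erase.2 ⟨hS₀, hwS₀⟩)
    ((Finset.erase_subset w S).trans hS) hwcard
  have hinsert := herase.insert (Finset.notMem_erase w S)
  rw [Finset.insert_erase hwS] at hinsert
  exact hinsert hcard

theorem isGreedyOrder_getElem {r : ℕ} {l : List V} (hl : l.Nodup) (hlJ : l.toFinset = J)
    (hlen : l.length = #J) (hr : r ≤ #J) (hJ : G.IsIndepSet (J : Set V))
    (hI : G.IsIndepSet (I : Set V)) {j : Fin #J → V} (hj : Function.Injective j)
    (hsettled : ∀ (s : Fin #J) (t : ℕ), r ≤ t → s < t → j s ∈ settled G J I (l.take t).toFinset) :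
    IsGreedyOrder G r J I (fun s => l[(s : ℕ)]'(s.2.trans_eq hlen.symm)) j := by
  have mem_J (s : ℕ) (hs : s < l.length) : l[s] ∈ J :=
    hlJ ▸ List.mem_toFinset.2 (List.getElem_mem hs)
  have mem_I (s : Fin #J) : j s ∈ I := (mem_settled.1 (hsettled s #J hr s.2)).1
  refine ⟨fun s t hst => Fin.ext (hl.getElem_inj_iff.1 hst), fun s => mem_J s _, hj, mem_I,
    fun t hrt _ => ?_⟩
  have not_adj (s u : Fin #J) (hs : s < t) (hu : t ≤ u) :
      ¬ G.Adj (j s) (l[(u : ℕ)]'(u.2.trans_eq hlen.symm)) := fun hadj => by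
    have hmem := (mem_settled.1 (hsettled s t hrt hs)).2 _ (mem_J u _) hadj
    obtain ⟨q, hq, hqu⟩ := List.mem_take_iff_getElem.1 (List.mem_toFinset.1 hmem)
    have := hl.getElem_inj_iff.1 hqu
    omega
  refine isIndepSet_union (hI.mono ?_) (hJ.mono ?_) ?_
  · rintro _ ⟨s, -, rfl⟩
    exact mem_I s
  · rintro _ ⟨s, -, rfl⟩
    exact mem_J s _
  · rintro _ ⟨s, hs, rfl⟩ _ ⟨u, hu, rfl⟩
    exact not_adj s u hs hu

theorem HasSettlingOrder.isWeaklyGreedyWith (h : HasSettlingOrder G J I Z J)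
    (hJ : G.IsIndepSet (J : Set V)) (hI : G.IsIndepSet (I : Set V)) (hcard : 2 ≤ #J)
    (hab : a ≠ b) (ha : a ∈ settled G J I Z) (hb : b ∈ settled G J I Z) :
    IsWeaklyGreedyWith G J I a b := by
  obtain ⟨l, hl, hlJ, hZ, hseg⟩ := h
  have hlen : l.length = #J := by rw [← hlJ, List.toFinset_card_of_nodup hl]
  have seg_mono {s t : ℕ} (hst : s ≤ t) :
      settled G J I (l.take s).toFinset ⊆ settled G J I (l.take t).toFinset :=
    settled_mono fun x hx => List.mem_toFinset.2
      ((List.take_prefix_take_left hst).subset (List.mem_toFinset.1 hx))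
  obtain ⟨j, hj, j_zero, j_one, hjF⟩ := exists_injective_zero_one_forall_mem hcard
    (F := fun t => settled G J I (l.take (t + 1)).toFinset) hab
    fun t ht => hseg (t + 1) (by omega) (t.2.trans_eq hlen.symm)
  have hZseg (t : ℕ) (ht : 2 ≤ t) : settled G J I Z ⊆ settled G J I (l.take t).toFinset :=
    (settled_mono hZ).trans (seg_mono ht)
  refine ⟨hcard, _, j, isGreedyOrder_getElem hl hlJ hlen hcard hJ hI hj ?_, j_zero, j_one⟩
  rintro ⟨_ | _ | s, hs⟩ t ht hst
  · exact j_zero ▸ hZseg t ht ha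
  · exact j_one ▸ hZseg t ht hb
  · exact seg_mono hst (hjF _ (Nat.le_add_left 2 s))

theorem isWeaklyGreedyWith_of_surplus (hdeg : ∀ v ∈ I, #{u ∈ J | G.Adj v u} ≤ 2)
    (hJ : G.IsIndepSet (J : Set V)) (hI : G.IsIndepSet (I : Set V)) (hcard : 2 ≤ #J)
    (hJI : #J ≤ #I) (hZ : #Z ≤ 2) (hZS₀ : Z ⊆ S₀) (hS₀Z : #S₀ ≤ #Z + 1) (hS₀ : S₀ ⊆ J)
    (hsurplus : #S₀ < #(settled G J I S₀)) (hab : a ≠ b) (ha : a ∈ settled G J I Z)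
    (hb : b ∈ settled G J I Z) : IsWeaklyGreedyWith G J I a b := by
  have hZsettled : #Z ≤ #(settled G J I Z) :=
    hZ.trans (Finset.one_lt_card.2 ⟨a, ha, b, hb, hab⟩)
  have horder : HasSettlingOrder G J I Z S₀ := by
    obtain rfl | hss := hZS₀.eq_or_ssubset
    · exact hasSettlingOrder_self hZ hZsettled
    · obtain ⟨w, hw, hwZ⟩ := Finset.exists_of_ssubset hss
      obtain rfl : insert w Z = S₀ := Finset.eq_of_subset_of_card_le
        (Finset.insert_subset hw hZS₀) (by rwa [Finset.card_insert_of_notMem hwZ])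
      exact (hasSettlingOrder_self hZ hZsettled).insert hwZ hsurplus.le
  exact (hasSettlingOrder_of_surplus hdeg hS₀ subset_rfl hsurplus (by rwa [settled_self])
    horder).isWeaklyGreedyWith hJ hI hcard hab ha hb

end GreedyOrder

section Clean

theorem isGreedy_of_card_le_one {V : Type*} {G : SimpleGraph V} {J I : Finset V}
    (hJ : #J ≤ 1) (hJI : #J ≤ #I) : IsGreedy G J I := by
  have hsub : Subsingleton (Fin #J) := Fin.subsingleton_iff_le_one.2 hJ
  refine ⟨fun a => J.equivFin.symm a, fun a => I.equivFin.symm (a.castLE hJI),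
    Function.injective_of_subsingleton _, fun a => (J.equivFin.symm a).2,
    Function.injective_of_subsingleton _, fun a => (I.equivFin.symm _).2, fun t _ _ => ?_⟩
  refine Set.Subsingleton.pairwise ?_ _
  rintro _ (⟨a, ha, rfl⟩ | ⟨a, ha, rfl⟩) _ (⟨b, hb, rfl⟩ | ⟨b, hb, rfl⟩) <;>
    obtain rfl := Subsingleton.elim a b
  · rfl
  · exact absurd ha hb.not_gt
  · exact absurd hb ha.not_gt
  · rfl

theorem card_union_inter_le_add_one {V : Type*} [DecidableEq V] {Y Y' J : Finset V} {x : V}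
    (hx : x ∈ Y) (hx' : x ∈ Y') (hY' : #Y' = 2) :
    #((Y ∪ Y') ∩ J) ≤ #(Y ∩ J) + 1 := by
  calc #((Y ∪ Y') ∩ J) ≤ #(Y ∩ J ∪ Y'.erase x) := Finset.card_le_card (by grind)
    _ ≤ #(Y ∩ J) + #(Y'.erase x) := Finset.card_union_le _ _
    _ = #(Y ∩ J) + 1 := by rw [Finset.card_erase_of_mem hx', hY']

variable {V : Type*} [Fintype V] [DecidableEq V] {G : SimpleGraph V} [DecidableRel G.Adj]
  {X Y Y' J I : Finset V} {x : V}

theorem projClass_inter_subset_settled (hJ : J ⊆ X) :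
    projClass G X Y ∩ I ⊆ settled G J I (Y ∩ J) := by
  intro v hv
  obtain ⟨hvY, hvI⟩ := Finset.mem_inter.1 hv
  refine mem_settled.2 ⟨hvI, fun u hu huv => Finset.mem_inter.2 ⟨?_, hu⟩⟩
  rw [← (mem_projClass.1 hvY).2]
  exact Finset.mem_filter.2 ⟨hJ hu, huv⟩

theorem card_neighbors_le_two_of_mem_twoClassVertices {v : V} (hJ : J ⊆ X)
    (hv : v ∈ twoClassVertices G X) :
    #{u ∈ J | G.Adj v u} ≤ 2 :=
  (Finset.card_le_card (Finset.filter_subset_filter _ hJ)).trans (mem_twoClassVertices.1 hv).2.le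

theorem isThreeClean_of_three_le_card (hJX : J ⊆ X) (hJ : G.IsIndepSet (J : Set V))
    (hI : G.IsIndepSet (I : Set V)) (hIX : I ⊆ twoClassVertices G X) (hcard : 2 ≤ #J)
    (hJI : #J ≤ #I) (hYX : Y ⊆ X) (hY : #Y = 2) (hYI : 3 ≤ #(projClass G X Y ∩ I)) :
    IsThreeClean G X J I := by
  have hsub := projClass_inter_subset_settled (G := G) (Y := Y) (I := I) hJX
  have hZ : #(Y ∩ J) ≤ 2 := hY ▸ Finset.card_le_card Finset.inter_subset_left
  obtain ⟨a, ha, b, hb, hab⟩ := Finset.one_lt_card.1 (show 1 < #(projClass G X Y ∩ I) by omega)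
  exact ⟨Y, hYX, hY, hYI, a, (Finset.mem_inter.1 ha).1, b, (Finset.mem_inter.1 hb).1,
    isWeaklyGreedyWith_of_surplus
      (fun v hv => card_neighbors_le_two_of_mem_twoClassVertices hJX (hIX hv)) hJ hI hcard hJI
      hZ subset_rfl (Nat.le_succ _) Finset.inter_subset_right
      ((Nat.lt_succ_of_le hZ).trans_le (hYI.trans (Finset.card_le_card hsub)))
      hab (hsub ha) (hsub hb)⟩

theorem four_le_card_settled_union_inter (hJX : J ⊆ X) (hne : Y ≠ Y')
    (hYI : 2 ≤ #(projClass G X Y ∩ I)) (hYI' : 2 ≤ #(projClass G X Y' ∩ I)) :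
    4 ≤ #(settled G J I ((Y ∪ Y') ∩ J)) := by
  have hdisj : Disjoint (projClass G X Y ∩ I) (projClass G X Y' ∩ I) :=
    Finset.disjoint_left.2 fun v hv hv' =>
      hne (eq_of_mem_projClass (Finset.mem_inter.1 hv).1 (Finset.mem_inter.1 hv').1)
  calc 4 ≤ #(projClass G X Y ∩ I ∪ projClass G X Y' ∩ I) := by
        rw [Finset.card_union_of_disjoint hdisj]
        omega
    _ ≤ #(settled G J I ((Y ∪ Y') ∩ J)) := Finset.card_le_card <| Finset.union_subset
        ((projClass_inter_subset_settled hJX).trans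
          (settled_mono (Finset.inter_subset_inter_right Finset.subset_union_left)))
        ((projClass_inter_subset_settled hJX).trans
          (settled_mono (Finset.inter_subset_inter_right Finset.subset_union_right)))

theorem isTwoTwoClean_of_card_eq_two (hJX : J ⊆ X) (hJ : G.IsIndepSet (J : Set V))
    (hI : G.IsIndepSet (I : Set V)) (hIX : I ⊆ twoClassVertices G X) (hcard : 2 ≤ #J)
    (hJI : #J ≤ #I) (hYX : Y ⊆ X) (hYX' : Y' ⊆ X) (hY : #Y = 2) (hY' : #Y' = 2) (hne : Y ≠ Y')
    (hx : x ∈ Y) (hx' : x ∈ Y') (hYI : #(projClass G X Y ∩ I) = 2)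
    (hYI' : 2 ≤ #(projClass G X Y' ∩ I)) : IsTwoTwoClean G X J I := by
  obtain ⟨a, b, hab, hCab⟩ := Finset.card_eq_two.1 hYI
  have hsub := projClass_inter_subset_settled (G := G) (Y := Y) (I := I) hJX
  have hZ : #(Y ∩ J) ≤ 2 := hY ▸ Finset.card_le_card Finset.inter_subset_left
  have hunion := card_union_inter_le_add_one (J := J) hx hx' hY'
  have hfour := four_le_card_settled_union_inter hJX hne hYI.ge hYI'
  exact ⟨Y, hYX, Y', hYX', hY, hY', hne, ⟨x, hx, hx'⟩, hYI', a, b, hCab,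
    isWeaklyGreedyWith_of_surplus
      (fun v hv => card_neighbors_le_two_of_mem_twoClassVertices hJX (hIX hv)) hJ hI hcard hJI
      hZ (Finset.inter_subset_inter_right Finset.subset_union_left) hunion
      Finset.inter_subset_right (by omega) hab (hsub (by simp [hCab])) (hsub (by simp [hCab]))⟩

/-- `I` has three vertices in one 2-class, or two vertices in each of two 2-classes with a common
key vertex: the configurations that start off a 3-clean or (2,2)-clean set, without mention of `J`.
-/
def IsRich (G : SimpleGraph V) [DecidableRel G.Adj] (X I : Finset V) : Prop :=
  (∃ Y ⊆ X, #Y = 2 ∧ 3 ≤ #(projClass G X Y ∩ I)) ∨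
  ∃ Y ⊆ X, ∃ Y' ⊆ X, #Y = 2 ∧ #Y' = 2 ∧ Y ≠ Y' ∧ (∃ x, x ∈ Y ∧ x ∈ Y') ∧
    2 ≤ #(projClass G X Y ∩ I) ∧ 2 ≤ #(projClass G X Y' ∩ I)

theorem IsRich.mono {I' : Finset V} (h : IsRich G X I) (hI : I ⊆ I') : IsRich G X I' := by
  have card_mono (Y) : #(projClass G X Y ∩ I) ≤ #(projClass G X Y ∩ I') :=
    Finset.card_le_card (Finset.inter_subset_inter_left hI)
  obtain ⟨Y, hYX, hY, hYI⟩ | ⟨Y, hYX, Y', hYX', hY, hY', hne, hx, hYI, hYI'⟩ := h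
  · exact .inl ⟨Y, hYX, hY, hYI.trans (card_mono Y)⟩
  · exact .inr ⟨Y, hYX, Y', hYX', hY, hY', hne, hx, hYI.trans (card_mono Y),
      hYI'.trans (card_mono Y')⟩

theorem IsRich.isClean (h : IsRich G X I) (hJX : J ⊆ X) (hJ : G.IsIndepSet (J : Set V))
    (hI : G.IsIndepSet (I : Set V)) (hIX : I ⊆ twoClassVertices G X) (hcard : 2 ≤ #J)
    (hJI : #J ≤ #I) : IsClean G X J I := by
  obtain ⟨Y, hYX, hY, hYI⟩ | ⟨Y, hYX, Y', hYX', hY, hY', hne, ⟨x, hx, hx'⟩, hYI, hYI'⟩ := h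
  · exact .inr (.inl (isThreeClean_of_three_le_card hJX hJ hI hIX hcard hJI hYX hY hYI))
  obtain hthree | htwo := hYI.lt_or_eq
  · exact .inr (.inl (isThreeClean_of_three_le_card hJX hJ hI hIX hcard hJI hYX hY hthree))
  · exact .inr (.inr (isTwoTwoClean_of_card_eq_two hJX hJ hI hIX hcard hJI hYX hYX' hY hY' hne
      hx hx' htwo.symm hYI'))

end Clean

section RichSets

theorem mul_card_le_card_of_pairwiseDisjoint {V : Type*} {X : Finset V}
    {ℬ : Finset (Finset V)} {d : ℕ} (hX : ∀ Y ∈ ℬ, Y ⊆ X) (hd : ∀ Y ∈ ℬ, #Y = d)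
    (hdisj : (ℬ : Set (Finset V)).PairwiseDisjoint id) : #ℬ * d ≤ #X := by
  classical
  calc #ℬ * d = ∑ Y ∈ ℬ, #Y := (Finset.sum_const_nat hd).symm
    _ = #(ℬ.biUnion id) := (Finset.card_biUnion hdisj).symm
    _ ≤ #X := Finset.card_le_card (Finset.biUnion_subset.2 hX)

theorem exists_ne_pair_eq_of_card_eq_two {V : Type*} [DecidableEq V] {Y : Finset V} {x : V}
    (hY : #Y = 2) (hx : x ∈ Y) : ∃ y ≠ x, {x, y} = Y := by
  obtain ⟨y, hy⟩ : ∃ y, Y.erase x = {y} :=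
    Finset.card_eq_one.1 (by rw [Finset.card_erase_of_mem hx, hY])
  exact ⟨y, Finset.ne_of_mem_erase (hy ▸ Finset.mem_singleton_self y),
    by rw [← hy, Finset.insert_erase hx]⟩

variable {V : Type*} [Fintype V] [DecidableEq V] {G : SimpleGraph V} [DecidableRel G.Adj]
  {X Y Y' W : Finset V} {x y z : V}

theorem exists_isRich_of_six_le_card (hG : ¬ IsMinor K₅ G) (hYX : Y ⊆ X) (hY : #Y = 2)
    (hYW : 6 ≤ #(projClass G X Y ∩ W)) :
    ∃ Q ⊆ W, G.IsIndepSet (Q : Set V) ∧ #Q ≤ 4 ∧ IsRich G X Q := by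
  obtain ⟨x, y, hxy, rfl⟩ := Finset.card_eq_two.1 hY
  have adj_of_mem {u c : V} (hu : u ∈ ({x, y} : Finset V)) (hc : c ∈ projClass G X {x, y} ∩ W) :
      G.Adj u c := (adj_of_mem_projClass (Finset.mem_inter.1 hc).1 hu).symm
  obtain ⟨T, hT, hTcard, hTindep⟩ := exists_isIndepSet_card_three_of_common_neighbors hG hxy
    (fun c => adj_of_mem (by simp)) (fun c => adj_of_mem (by simp)) hYW
  obtain ⟨hTY, hTW⟩ := Finset.subset_inter_iff.1 hT
  refine ⟨T, hTW, hTindep, by omega, .inl ⟨_, hYX, hY, ?_⟩⟩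
  rw [Finset.inter_eq_right.2 hTY, hTcard]

theorem isWedge_projClass_inter (hxy : x ≠ y) (hxz : x ≠ z) (hyz : y ≠ z) (hy : y ∈ X)
    (hz : z ∈ X) : IsWedge G x y z (projClass G X {x, y} ∩ W) (projClass G X {x, z} ∩ W) where
  ne_left := hxy
  ne_right := hxz
  ne_ends := hyz
  disjoint := Finset.disjoint_left.2 fun c hc hc' => by
    have heq := eq_of_mem_projClass (Finset.mem_inter.1 hc).1 (Finset.mem_inter.1 hc').1
    have hmem : y ∈ ({x, z} : Finset V) := heq ▸ by simp
    simp [hxy.symm, hyz] at hmem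
  adj_apex c hc := (adj_of_mem_projClass (Finset.mem_inter.1 hc).1 (by simp)).symm
  adj_apex' c hc := (adj_of_mem_projClass (Finset.mem_inter.1 hc).1 (by simp)).symm
  adj_left c hc := (adj_of_mem_projClass (Finset.mem_inter.1 hc).1 (by simp)).symm
  adj_right c hc := (adj_of_mem_projClass (Finset.mem_inter.1 hc).1 (by simp)).symm
  left_notMem h := (mem_projClass.1 (Finset.mem_inter.1 h).1).1 hy
  right_notMem h := (mem_projClass.1 (Finset.mem_inter.1 h).1).1 hz

theorem exists_isRich_of_four_le_card (hG : ¬ IsMinor K₅ G) (hG' : ¬ IsMinor K₃₃ G) (hYX : Y ⊆ X)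
    (hYX' : Y' ⊆ X) (hY : #Y = 2) (hY' : #Y' = 2) (hne : Y ≠ Y') (hx : x ∈ Y) (hx' : x ∈ Y')
    (hYW : 4 ≤ #(projClass G X Y ∩ W)) (hYW' : 4 ≤ #(projClass G X Y' ∩ W)) :
    ∃ Q ⊆ W, G.IsIndepSet (Q : Set V) ∧ #Q ≤ 4 ∧ IsRich G X Q := by
  obtain ⟨y, hy, rfl⟩ := exists_ne_pair_eq_of_card_eq_two hY hx
  obtain ⟨z, hz, rfl⟩ := exists_ne_pair_eq_of_card_eq_two hY' hx'
  have hyz : y ≠ z := fun h => hne (h ▸ rfl)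
  obtain ⟨P, hP, P', hP', hPcard, hPcard', hindep⟩ :=
    (isWedge_projClass_inter (G := G) (W := W) hy.symm hz.symm hyz (hYX (by simp))
      (hYX' (by simp))).exists_isIndepSet_union hG hG' hYW hYW'
  obtain ⟨hPY, hPW⟩ := Finset.subset_inter_iff.1 hP
  obtain ⟨hPY', hPW'⟩ := Finset.subset_inter_iff.1 hP'
  refine ⟨P ∪ P', Finset.union_subset hPW hPW', by rwa [Finset.coe_union],
    (Finset.card_union_le P P').trans (by omega), .inr ⟨_, hYX, _, hYX', hY, hY', hne,
      ⟨x, hx, hx'⟩, ?_, ?_⟩⟩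
  · exact hPcard ▸ Finset.card_le_card (Finset.subset_inter hPY Finset.subset_union_left)
  · exact hPcard' ▸ Finset.card_le_card (Finset.subset_inter hPY' Finset.subset_union_right)

theorem card_le_of_card_projClass_inter_le (hW : W ⊆ twoClassVertices G X) {m n : ℕ}
    (hn : ∀ Y ∈ X.powersetCard 2, #(projClass G X Y ∩ W) ≤ m + n) :
    #W ≤ m * #{Y ∈ X.powersetCard 2 | (projClass G X Y).Nonempty} +
      n * #{Y ∈ X.powersetCard 2 | m < #(projClass G X Y ∩ W)} := by
  have hcover : W ⊆ {Y ∈ X.powersetCard 2 | (projClass G X Y).Nonempty}.biUnion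
      fun Y => projClass G X Y ∩ W := fun v hv => by
    obtain ⟨Y, hY, hvY⟩ := Finset.mem_biUnion.1 (hW hv)
    exact Finset.mem_biUnion.2 ⟨Y, Finset.mem_filter.2 ⟨hY, v, hvY⟩, Finset.mem_inter.2 ⟨hvY, hv⟩⟩
  calc #W ≤ ∑ Y ∈ X.powersetCard 2 with (projClass G X Y).Nonempty, #(projClass G X Y ∩ W) :=
        (Finset.card_le_card hcover).trans Finset.card_biUnion_le
    _ ≤ ∑ Y ∈ X.powersetCard 2, ((if (projClass G X Y).Nonempty then m else 0) +
          if m < #(projClass G X Y ∩ W) then n else 0) := by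
        rw [Finset.sum_filter]
        refine Finset.sum_le_sum fun Y hY => ?_
        have := hn Y hY
        split_ifs <;> omega
    _ = _ := by
        simp only [Finset.sum_add_distrib, ← Finset.sum_filter, Finset.sum_const, smul_eq_mul,
          mul_comm]

-- A class with six vertices of `W` contains a rich triple. Otherwise the classes with at least four
-- vertices of `W` have pairwise disjoint key pairs, or two of them span a rich quadruple; so there
-- are at most `#X / 2` of these, and fewer than `3 * #X` classes altogether.
theorem exists_isRich (hG : ¬ IsMinor K₅ G) (hG' : ¬ IsMinor K₃₃ G) (hX : 2 ≤ #X)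
    (hW : W ⊆ twoClassVertices G X) (hcard : 10 * #X < #W + 15) :
    ∃ Q ⊆ W, G.IsIndepSet (Q : Set V) ∧ #Q ≤ 4 ∧ IsRich G X Q := by
  by_contra hrich
  have card_le_five (Y) (hY : Y ∈ X.powersetCard 2) : #(projClass G X Y ∩ W) ≤ 3 + 2 := by
    obtain ⟨hYX, hY2⟩ := Finset.mem_powersetCard.1 hY
    by_contra! h
    exact hrich (exists_isRich_of_six_le_card hG hYX hY2 h)
  set big := {Y ∈ X.powersetCard 2 | 3 < #(projClass G X Y ∩ W)}
  have mem_big {Y} (hY : Y ∈ big) : Y ⊆ X ∧ #Y = 2 ∧ 4 ≤ #(projClass G X Y ∩ W) := by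
    simpa [big, Nat.succ_le_iff, and_assoc] using hY
  have big_disjoint : (big : Set (Finset V)).PairwiseDisjoint id := by
    refine fun Y hY Y' hY' hne => Finset.disjoint_left.2 fun x hx hx' => hrich ?_
    obtain ⟨⟨hYX, hY2, hYW⟩, hYX', hY2', hYW'⟩ := And.intro (mem_big hY) (mem_big hY')
    exact exists_isRich_of_four_le_card hG hG' hYX hYX' hY2 hY2' hne hx hx' hYW hYW'
  have hbig : #big * 2 ≤ #X := mul_card_le_card_of_pairwiseDisjoint (fun _ hY => (mem_big hY).1)
    (fun _ hY => (mem_big hY).2.1) big_disjoint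
  have hWcard : #W ≤ 3 * _ + 2 * #big := card_le_of_card_projClass_inter_le hW card_le_five
  have hclasses := card_nonempty_twoClasses_add_five_le hG hX
  omega

end RichSets

section Extension

variable {V : Type*} {G : SimpleGraph V} [DecidableRel G.Adj] {W Q : Finset V}

theorem exists_isIndepSet_superset {d : ℕ} (hG : ¬ IsMinor K₅ G) (hQW : Q ⊆ W)
    (hQ : G.IsIndepSet (Q : Set V)) (hd : ∀ q ∈ Q, #{w ∈ W | G.Adj q w} ≤ d) :
    ∃ I, Q ⊆ I ∧ I ⊆ W ∧ G.IsIndepSet (I : Set V) ∧ #W ≤ #Q * (d + 1) + 6 * #I := by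
  classical
  set N := Q ∪ Q.biUnion fun q => {w ∈ W | G.Adj q w}
  have hN : #N ≤ #Q * (d + 1) :=
    calc #N ≤ #Q + #Q * d := (Finset.card_union_le _ _).trans
          (Nat.add_le_add_left (Finset.card_biUnion_le_card_mul _ _ _ hd) _)
      _ = #Q * (d + 1) := by ring
  obtain ⟨S, hS, hSindep, hScard⟩ := exists_isIndepSet_card_le_mul (S := W \ N) (d := 5)
    fun T _ hT => exists_card_neighbors_le_five hG hT
  refine ⟨Q ∪ S, Finset.subset_union_left,
    Finset.union_subset hQW (hS.trans Finset.sdiff_subset), ?_, ?_⟩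
  · rw [Finset.coe_union]
    refine isIndepSet_union hQ hSindep fun q hq w hw hqw => ?_
    obtain ⟨hwW, hwN⟩ := Finset.mem_sdiff.1 (hS hw)
    exact hwN (Finset.mem_union_right _
      (Finset.mem_biUnion.2 ⟨q, hq, Finset.mem_filter.2 ⟨hwW, hqw⟩⟩))
  · have hWN := Finset.le_card_sdiff N W
    have hSI := Finset.card_le_card (Finset.subset_union_right (s₁ := Q) (s₂ := S))
    omega

variable [Fintype V] [DecidableEq V] {X : Finset V} {d k : ℕ}

theorem card_filter_le_card_neighbors_le_fourteen (hG : ¬ IsMinor K₅ G) (hX : 2 ≤ #X)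
    (hXk : #X ≤ 2 * k) (hW : W ⊆ twoClassVertices G X) (hWk : #W = 21 * k)
    (hd : 15 * k ≤ 4 * d) : #{v ∈ W | d ≤ #{w ∈ W | G.Adj v w}} ≤ 14 := by
  have hdisj : Disjoint X W :=
    Finset.disjoint_right.2 fun v hv => (mem_twoClassVertices.1 (hW hv)).1
  have hsum := sum_card_neighbors_add_le_of_le_card_neighbors hG hX hdisj
    fun w hw => (mem_twoClassVertices.1 (hW hw)).2.ge
  set T := {v ∈ W | d ≤ #{w ∈ W | G.Adj v w}}
  have hT : #T * d ≤ ∑ v ∈ W, #{w ∈ W | G.Adj v w} :=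
    (Finset.card_nsmul_le_sum T _ d fun v hv => (Finset.mem_filter.1 hv).2).trans
      (Finset.sum_le_sum_of_subset (Finset.filter_subset _ _))
  by_contra! hlt
  have := Nat.mul_le_mul_right d hlt
  omega

-- At most 14 vertices of `W` have degree at least `15 * k / 4` within `W`. A rich set chosen among
-- the others dominates fewer than `15 * k + 4` of the `21 * k` vertices of `W`, and a sixth of the
-- rest is independent.
theorem exists_isRich_isIndepSet_superset (hG : ¬ IsMinor K₅ G) (hG' : ¬ IsMinor K₃₃ G)
    (hX : 2 ≤ #X) (hXk : #X ≤ 2 * k) (hcard : 21 * k ≤ #(twoClassVertices G X)) :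
    ∃ Q I, Q ⊆ I ∧ I ⊆ twoClassVertices G X ∧ G.IsIndepSet (I : Set V) ∧ #Q ≤ 4 ∧ k ≤ #I ∧
      IsRich G X Q := by
  obtain ⟨W, hW, hWk⟩ := Finset.exists_subset_card_eq hcard
  obtain ⟨d, hd, hd'⟩ : ∃ d, 4 * d < 15 * k ∧ 15 * k ≤ 4 * (d + 1) :=
    ⟨(15 * k - 1) / 4, by omega, by omega⟩
  have hhigh := card_filter_le_card_neighbors_le_fourteen hG hX hXk hW hWk hd'
  have hsplit := Finset.card_filter_add_card_filter_not (s := W)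
    fun v => d + 1 ≤ #{w ∈ W | G.Adj v w}
  obtain ⟨Q, hQ, hQindep, hQcard, hQrich⟩ := exists_isRich hG hG' hX
    ((Finset.filter_subset (fun v => ¬ d + 1 ≤ #{w ∈ W | G.Adj v w}) W).trans hW) (by omega)
  obtain ⟨I, hQI, hIW, hI, hIcard⟩ := exists_isIndepSet_superset hG
    (hQ.trans (Finset.filter_subset _ _)) hQindep
    fun q hq => Nat.le_of_not_lt (Finset.mem_filter.1 (hQ hq)).2
  have := Nat.mul_le_mul_right (d + 1) hQcard
  exact ⟨Q, I, hQI, hIW.trans hW, hI, hQcard, by omega, hQrich⟩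

end Extension

end TokenJumping

theorem mainTheorem5 {V : Type*} [Fintype V] [DecidableEq V] (G : SimpleGraph V)
    [DecidableRel G.Adj] (hG : TokenJumping.IsPlanar G) (k : ℕ) (Is It : Finset V)
    (hIs : G.IsIndepSet (Is : Set V)) (hIt : G.IsIndepSet (It : Set V))
    (hIsk : #Is = k) (hItk : #It = k)
    (h21 : 21 * k ≤ #(TokenJumping.twoClassVertices G (Is ∪ It))) :
    ∃ I : Finset V, I ⊆ TokenJumping.twoClassVertices G (Is ∪ It) ∧
      G.IsIndepSet (I : Set V) ∧ #I ≤ 2 * k ∧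
      TokenJumping.IsClean G (Is ∪ It) Is I ∧ TokenJumping.IsClean G (Is ∪ It) It I := by
  have hsX : Is ⊆ Is ∪ It := Finset.subset_union_left
  have htX : It ⊆ Is ∪ It := Finset.subset_union_right
  obtain hk | hk := Nat.lt_or_ge k 2
  · obtain ⟨I, hI, hIk⟩ := Finset.exists_subset_card_eq (le_trans (by omega : k ≤ 21 * k) h21)
    have hIsub : (I : Set V).Subsingleton := Finset.card_le_one_iff_subsingleton.1 (by omega)
    exact ⟨I, hI, hIsub.pairwise _, by omega,
      .inl (TokenJumping.isGreedy_of_card_le_one (by omega) (by omega)),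
      .inl (TokenJumping.isGreedy_of_card_le_one (by omega) (by omega))⟩
  · have hX : 2 ≤ #(Is ∪ It) := hk.trans (hIsk ▸ Finset.card_le_card hsX)
    have hXk : #(Is ∪ It) ≤ 2 * k := (Finset.card_union_le _ _).trans (by omega)
    obtain ⟨Q, I₀, hQI₀, hI₀, hI₀indep, hQ, hkI₀, hrich⟩ :=
      TokenJumping.exists_isRich_isIndepSet_superset hG.not_isMinor_K₅ hG.not_isMinor_K₃₃ hX hXk h21
    obtain ⟨I, hQI, hII₀, hI⟩ := Finset.exists_subsuperset_card_eq hQI₀ (le_max_left #Q k)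
      (max_le (Finset.card_le_card hQI₀) hkI₀)
    have hIindep : G.IsIndepSet (I : Set V) := hI₀indep.mono (Finset.coe_subset.2 hII₀)
    have hclean {J : Finset V} (hJX : J ⊆ Is ∪ It) (hJ : G.IsIndepSet (J : Set V)) (hJk : #J = k) :
        TokenJumping.IsClean G (Is ∪ It) J I :=
      (hrich.mono hQI).isClean hJX hJ hIindep (hII₀.trans hI₀) (by omega) (by omega)
    exact ⟨I, hII₀.trans hI₀, hIindep, by omega, hclean hsX hIs hIsk, hclean htX hIt hItk⟩
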